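/- Let $n\ge 3$, let $w'\in S_n$ be an $(n-1)$-cycle, and consider representations of $S_n$ over $\mathbb{C}$. Parametrize the irreducible representations of $S_n$ by partitions of $n$ in the standard way (the partition $\lambda$ corresponds to the Specht module $S^\lambda$, so that $(n)$ corresponds to the trivial representation and $(1^n)$ to the sign representation). Define ${}'\Lambda^i$ for $0\le i\le n-2$ as follows: ${}'\Lambda^0$ is the trivial representation; for $1\le i\le n-3$, ${}'\Lambda^i$ is the irreducible representation corresponding to the partition of $n$ with parts $n-i-1,\,2,\,1,\dots,1$ (with $i-1$ parts equal to $1$); and ${}'\Lambda^{n-2}$ is the sign representation. Then each ${}'\Lambda^i$ is irreducible and $$\operatorname{tr}(w',{}'\Lambda^i)=(-1)^i\qquad\text{for } 0\le i\le n-2 .$$ Moreover, if $E$ is an irreducible complex representation of $S_n$ that is not isomorphic to any of ${}'\Lambda^0,\dots,{}'\Lambda^{n-2}$, then $\operatorname{tr}(w',E)=0$. -/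

import Mathlib

/-- The permutation representation of `S_n` on the complex vector space with basis all
functions `f : Fin n → ℕ`, where `g` sends the basis vector `f` to `f ∘ g⁻¹`. -/
noncomputable def rowFillingRep (n : ℕ) :
    Representation ℂ (Equiv.Perm (Fin n)) ((Fin n → ℕ) →₀ ℂ) where
  toFun g := Finsupp.lmapDomain ℂ ℂ (fun f : Fin n → ℕ => f ∘ ⇑g⁻¹)
  map_one' := by
    ext f : 2
    simp
  map_mul' g h := by
    ext f : 2
    simp [Function.comp_assoc]

/-- A Young tableau of shape `μ` with entries `Fin n`, each used once: the entry `k` sits in the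
cell `t k = (row, column)` of the diagram. There are none unless `μ` has `n` cells. -/
abbrev YTableau (n : ℕ) (μ : YoungDiagram) : Type := Fin n ≃ {c : ℕ × ℕ // c ∈ μ.cells}

/-- The row in which each entry of the tableau lies. Two tableaux have the same
`rowOf` exactly if they are row equivalent, so `rowOf t` is the tabloid of `t`. -/
def YTableau.rowOf {n : ℕ} {μ : YoungDiagram} (t : YTableau n μ) : Fin n → ℕ :=
  fun k => (t k).1.1

/-- The column in which each entry of the tableau lies. -/
def YTableau.colOf {n : ℕ} {μ : YoungDiagram} (t : YTableau n μ) : Fin n → ℕ :=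
  fun k => (t k).1.2

/-- The polytabloid `e_t = ∑ sgn(q) {q t}`, the sum over all permutations `q` that preserve
each column of `t`; the entry `k` of `q t` lies where the entry `q⁻¹ k` of `t` lies. -/
noncomputable def YTableau.polytabloid {n : ℕ} {μ : YoungDiagram} (t : YTableau n μ) :
    (Fin n → ℕ) →₀ ℂ :=
  ∑ q ∈ Finset.univ.filter (fun q : Equiv.Perm (Fin n) => t.colOf ∘ ⇑q = t.colOf),
    Finsupp.single (t.rowOf ∘ ⇑q⁻¹) (((Equiv.Perm.sign q : ℤˣ) : ℤ) : ℂ)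

theorem YTableau.rowFillingRep_polytabloid {n : ℕ} {μ : YoungDiagram} (t : YTableau n μ)
    (g : Equiv.Perm (Fin n)) :
    rowFillingRep n g t.polytabloid = YTableau.polytabloid (g⁻¹.trans t : YTableau n μ) := by
  classical
  simp only [YTableau.polytabloid, map_sum]
  refine Finset.sum_bij' (fun q _ => g * q * g⁻¹) (fun q _ => g⁻¹ * q * g) ?_ ?_ ?_ ?_ ?_
  · intro q hq
    simp only [Finset.mem_filter, Finset.mem_univ, true_and] at hq ⊢
    funext k
    have := congrFun hq (g⁻¹ k)
    simpa [YTableau.colOf] using this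
  · intro q hq
    simp only [Finset.mem_filter, Finset.mem_univ, true_and] at hq ⊢
    funext k
    have := congrFun hq (g k)
    simpa [YTableau.colOf] using this
  · intro q _
    group
  · intro q _
    group
  · intro q _
    have h : (t.rowOf ∘ ⇑q⁻¹) ∘ ⇑g⁻¹ =
        YTableau.rowOf (g⁻¹.trans t : YTableau n μ) ∘ ⇑(g * q * g⁻¹)⁻¹ := by
      funext k
      simp [YTableau.rowOf]
    simp only [rowFillingRep, MonoidHom.coe_mk, OneHom.coe_mk, Finsupp.lmapDomain_apply,
      Finsupp.mapDomain_single, h]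
    rw [Equiv.Perm.sign_mul, Equiv.Perm.sign_mul, Equiv.Perm.sign_inv, mul_right_comm,
      Int.units_mul_self, one_mul]

/-- The Specht module of the diagram `μ` (with `n` cells): the span of all polytabloids of
shape `μ`, as a subrepresentation of the permutation representation. -/
noncomputable def specht (n : ℕ) (μ : YoungDiagram) : Subrepresentation (rowFillingRep n) where
  toSubmodule := Submodule.span ℂ (Set.range (YTableau.polytabloid (n := n) (μ := μ)))
  apply_mem_toSubmodule g v hv := by
    induction hv using Submodule.span_induction with
    | mem x hx =>
      obtain ⟨t, rfl⟩ := hx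
      rw [YTableau.rowFillingRep_polytabloid]
      exact Submodule.subset_span ⟨_, rfl⟩
    | zero => simp
    | add x y _ _ hx hy => rw [map_add]; exact add_mem hx hy
    | smul a x _ hx => rw [map_smul]; exact Submodule.smul_mem _ a hx

/-- The underlying vector space of the Specht module of `μ`. -/
def SpechtModule (n : ℕ) (μ : YoungDiagram) : Type := (specht n μ).toSubmodule

noncomputable instance SpechtModule.instAddCommGroup (n : ℕ) (μ : YoungDiagram) :
    AddCommGroup (SpechtModule n μ) :=
  inferInstanceAs (AddCommGroup (specht n μ).toSubmodule)

noncomputable instance SpechtModule.instModule (n : ℕ) (μ : YoungDiagram) :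
    Module ℂ (SpechtModule n μ) :=
  inferInstanceAs (Module ℂ (specht n μ).toSubmodule)

instance SpechtModule.instFinite (n : ℕ) (μ : YoungDiagram) :
    Module.Finite ℂ (SpechtModule n μ) :=
  Module.Finite.span_of_finite ℂ (Set.finite_range (YTableau.polytabloid (n := n) (μ := μ)))

/-- The action of `S_n` on the Specht module of `μ`. -/
noncomputable def spechtRep (n : ℕ) (μ : YoungDiagram) :
    Representation ℂ (Equiv.Perm (Fin n)) (SpechtModule n μ) :=
  (specht n μ).toRepresentation

/-- The sign representation of `S_n` on `ℂ`. -/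
noncomputable def signRep (n : ℕ) : Representation ℂ (Equiv.Perm (Fin n)) ℂ where
  toFun g := (((Equiv.Perm.sign g : ℤˣ) : ℤ) : ℂ) • LinearMap.id
  map_one' := by
    ext
    simp
  map_mul' g h := by
    ext
    simp [mul_comm]

/-- The diagram with row lengths `n - i - 1, 2, 1, …, 1` (with `i - 1` ones), where
`1 ≤ i ≤ n - 3`; it has `n` cells. -/
def lambdaPrimeShape (n i : ℕ) (h : i + 3 ≤ n) : YoungDiagram :=
  YoungDiagram.ofRowLens ((n - i - 1) :: 2 :: List.replicate (i - 1) 1) (by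
    rw [List.sortedGE_iff_pairwise]
    simp only [List.pairwise_cons, List.mem_cons, List.mem_replicate]
    refine ⟨?_, ?_, ?_⟩
    · rintro a (rfl | ⟨_, rfl⟩) <;> omega
    · rintro a ⟨_, rfl⟩
      omega
    · exact List.pairwise_replicate.2 (Or.inr le_rfl))

/-- The family `'Λ^i` of representations of `S_n`, `0 ≤ i ≤ n - 2`, for `n ≥ 3`: the trivial
representation for `i = 0`, the representation with partition `(1^{i-1}, 2, n-i-1)` for
`1 ≤ i ≤ n - 3`, and the sign representation for `i = n - 2`. -/
noncomputable def lambdaPrime (n : ℕ) (i : Fin (n - 1)) : FDRep ℂ (Equiv.Perm (Fin n)) :=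
  if (i : ℕ) = 0 then FDRep.of (Representation.trivial ℂ (Equiv.Perm (Fin n)) ℂ)
  else if h : (i : ℕ) + 3 ≤ n then
    FDRep.of (spechtRep n (lambdaPrimeShape n i h))
  else FDRep.of (signRep n)

/-! A point `z` fixed by the (n-1)-cycle is removed, so that the cycle becomes a full cycle `w` in
the symmetric group of the N = n-1 remaining points. For h in that group, Σ_A t^|A| `signOn A h` =
det(1 + t h) = ∏ (1 - (-t)^l) over the cycle lengths l of h. At t = -1 this vanishes, and its first
derivative survives only when h is a single cycle. Pairing both facts with a character χ gives two
linear relations (`sum_signOn_mul_function`, `sum_card_mul_signOn_mul_classFunction`) between χ(w)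
and the multiplicities in χ of the characters sign on A, trivial off A.

For `'Λ^i` these multiplicities vanish unless |A| is i or i+1, and they are nonzero when |A| = i.
Eliminating the size i+1 leaves χ(w) = (-1)^i r with r ≥ 1 (`character_cycle_of_hasSignInvariant`).
For Specht modules the vanishing is a pigeonhole argument on rows and on columns, and the
nonvanishing is a positive coefficient in a symmetrized polytabloid.

The centralizer of the cycle in S_n has order n-1. Bessel's inequality for the orthonormal
irreducible characters therefore bounds Σ |χ(w')|² by n-1 (`sum_norm_sq_character_cycle_le`). The
n-1 pairwise inequivalent representations `'Λ^i` already use up this bound, so every r equals 1 and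
every other irreducible character vanishes at w'. Orthogonality also needs irreducibility, which
comes from signed column sums (`SpechtModule.isIrreducible`). -/

open Equiv in
/-- The sign of the restriction of `h` to the set `A` if `h` preserves `A`, and `0` otherwise. -/
def signOn {α : Type*} [Fintype α] [DecidableEq α] (A : Finset α) (h : Perm α) : ℤ :=
  if H : ∀ x, h x ∈ A ↔ x ∈ A then ((Perm.sign (h.subtypePerm H) : ℤˣ) : ℤ) else 0

/-! ### Signs on stable subsets, and the alternating sums that detect full cycles -/

section SignOn

open Equiv Finset

variable {α : Type*} [Fintype α] [DecidableEq α]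

theorem signOn_of_stable {A : Finset α} {h : Perm α} (H : ∀ x, h x ∈ A ↔ x ∈ A) :
    signOn A h = ((Perm.sign (h.subtypePerm H) : ℤˣ) : ℤ) := dif_pos H

theorem signOn_of_not_stable {A : Finset α} {h : Perm α} (H : ¬ ∀ x, h x ∈ A ↔ x ∈ A) :
    signOn A h = 0 := dif_neg H

/-- Extending the restriction to A by the identity does not change its sign. This trades
permutations of a subtype for permutations of the whole type. -/
theorem signOn_eq_sign {A : Finset α} {g h : Perm α} (h1 : ∀ x ∈ A, g x = h x)
    (h2 : ∀ x, x ∉ A → g x = x) (H : ∀ x, h x ∈ A ↔ x ∈ A) :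
    signOn A h = ((Perm.sign g : ℤˣ) : ℤ) := by
  have Hg : ∀ x, g x ∈ A ↔ x ∈ A := by
    intro x
    by_cases hx : x ∈ A
    · rw [h1 x hx, H]
    · rw [h2 x hx]
  have hs := Perm.sign_subtypePerm g Hg (fun x hx => by
    by_contra hxA
    exact hx (h2 x hxA))
  have e : h.subtypePerm H = g.subtypePerm Hg := by
    ext x
    simp [h1 x x.2]
  rw [signOn_of_stable H, ← hs, e]
  congr!

theorem signOn_one (A : Finset α) : signOn A (1 : Perm α) = 1 := by
  rw [signOn_eq_sign (g := 1) (by simp) (by simp) (by simp)]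
  simp

theorem signOn_empty (h : Perm α) : signOn ∅ h = 1 := by
  rw [signOn_eq_sign (g := 1) (by simp) (by simp) (by simp)]
  simp

theorem signOn_mul {A : Finset α} {g h : Perm α} (Hg : ∀ x, g x ∈ A ↔ x ∈ A)
    (Hh : ∀ x, h x ∈ A ↔ x ∈ A) : signOn A (g * h) = signOn A g * signOn A h := by
  have H : ∀ x, (g * h) x ∈ A ↔ x ∈ A := fun x => by simp [Hg, Hh]
  rw [signOn_of_stable Hg, signOn_of_stable Hh, signOn_of_stable H, ← Units.val_mul,
    ← Perm.sign_mul]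
  congr 2

theorem signOn_mul_self {A : Finset α} {h : Perm α} (H : ∀ x, h x ∈ A ↔ x ∈ A) :
    signOn A h * signOn A h = 1 := by
  rw [signOn_of_stable H, ← Units.val_mul, Int.units_mul_self, Units.val_one]

omit [Fintype α] [DecidableEq α] in
theorem stable_inv {A : Finset α} {h : Perm α} (H : ∀ x, h x ∈ A ↔ x ∈ A) :
    ∀ x, h⁻¹ x ∈ A ↔ x ∈ A := fun x => by rw [← H (h⁻¹ x)]; simp

omit [Fintype α] in
theorem stable_swap_of_mem {A : Finset α} {a b : α} (ha : a ∈ A) (hb : b ∈ A) :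
    ∀ x, swap a b x ∈ A ↔ x ∈ A := by
  intro x
  rw [swap_apply_def]
  split_ifs with h1 h2
  · simp [h1, ha, hb]
  · simp [h2, ha, hb]
  · rfl

omit [Fintype α] in
theorem stable_swap_of_notMem {A : Finset α} {a b : α} (ha : a ∉ A) (hb : b ∉ A) :
    ∀ x, swap a b x ∈ A ↔ x ∈ A := by
  intro x
  rw [swap_apply_def]
  split_ifs with h1 h2
  · simp [h1, ha, hb]
  · simp [h2, ha, hb]
  · rfl

theorem signOn_swap_of_mem {A : Finset α} {a b : α} (ha : a ∈ A) (hb : b ∈ A) (hab : a ≠ b) :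
    signOn A (swap a b) = -1 := by
  rw [signOn_eq_sign (g := swap a b) (fun _ _ => rfl)
    (fun x hx => swap_apply_of_ne_of_ne (fun h => hx (h ▸ ha)) (fun h => hx (h ▸ hb)))
    (stable_swap_of_mem ha hb), Perm.sign_swap hab]
  rfl

theorem signOn_swap_of_notMem {A : Finset α} {a b : α} (ha : a ∉ A) (hb : b ∉ A) :
    signOn A (swap a b) = 1 := by
  rw [signOn_eq_sign (g := 1) (fun x hx => (swap_apply_of_ne_of_ne
    (ne_of_mem_of_not_mem hx ha) (ne_of_mem_of_not_mem hx hb)).symm) (by simp) (stable_swap_of_notMem ha hb)]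
  simp

theorem signOn_union {A B : Finset α} {h : Perm α} (hAB : Disjoint A B)
    (HA : ∀ x, h x ∈ A ↔ x ∈ A) (HB : ∀ x, h x ∈ B ↔ x ∈ B) :
    signOn (A ∪ B) h = signOn A h * signOn B h := by
  rw [disjoint_left] at hAB
  have key : ∀ {C : Finset α} (HC : ∀ x, h x ∈ C ↔ x ∈ C),
      (∀ x ∈ C, Perm.ofSubtype (h.subtypePerm HC) x = h x) ∧
      (∀ x, x ∉ C → Perm.ofSubtype (h.subtypePerm HC) x = x) := fun HC =>
    ⟨fun x hx => Perm.ofSubtype_apply_of_mem _ hx,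
      fun x hx => Perm.ofSubtype_apply_of_not_mem _ hx⟩
  rw [signOn_eq_sign (key HA).1 (key HA).2 HA, signOn_eq_sign (key HB).1 (key HB).2 HB,
    ← Units.val_mul, ← Perm.sign_mul]
  apply signOn_eq_sign
  · intro x hx
    rw [Perm.mul_apply]
    by_cases hxB : x ∈ B
    · rw [(key HB).1 x hxB, (key HA).2 _ (fun h' => hAB h' ((HB x).2 hxB))]
    · rw [(key HB).2 x hxB]
      exact (key HA).1 x (by simpa [hxB] using hx)
  · intro x hx
    rw [mem_union, not_or] at hx
    rw [Perm.mul_apply, (key HB).2 x hx.2, (key HA).2 x hx.1]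
  · intro x
    simp [HA, HB]

/-- The orbit of `y` under the powers of `h`. -/
def cycleSet (h : Perm α) (y : α) : Finset α := {x | h.SameCycle y x}

theorem mem_cycleSet {h : Perm α} {x y : α} : x ∈ cycleSet h y ↔ h.SameCycle y x := by
  simp [cycleSet]

theorem stable_cycleSet (h : Perm α) (y : α) : ∀ x, h x ∈ cycleSet h y ↔ x ∈ cycleSet h y := by
  intro x
  simp [mem_cycleSet]

theorem signOn_cycleSet (h : Perm α) (y : α) :
    signOn (cycleSet h y) h = -(-1) ^ #(cycleSet h y) := by
  rw [signOn_eq_sign (g := h.cycleOf y)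
    (fun x hx => Perm.SameCycle.cycleOf_apply (mem_cycleSet.1 hx))
    (fun x hx => Perm.cycleOf_apply_of_not_sameCycle (fun h' => hx (mem_cycleSet.2 h')))
    (stable_cycleSet h y)]
  -- A fixed point is separate: its orbit is a singleton, but the support of `h.cycleOf y` is then
  -- empty.
  by_cases hy : h y = y
  · have : cycleSet h y = {y} := by
      ext x
      rw [mem_cycleSet, mem_singleton]
      constructor
      · intro hxy
        exact (hxy.eq_of_left hy).symm
      · rintro rfl
        exact Perm.SameCycle.refl _ _
    rw [this, (Perm.cycleOf_eq_one_iff h).2 hy]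
    simp
  · have : cycleSet h y = (h.cycleOf y).support := by
      ext x
      rw [mem_cycleSet, Perm.mem_support_cycleOf_iff' hy]
    rw [this, (Perm.isCycle_cycleOf h hy).sign]
    simp

theorem stable_cycleSet_subset_or_disjoint {A : Finset α} {h : Perm α}
    (H : ∀ x, h x ∈ A ↔ x ∈ A) (y : α) : cycleSet h y ⊆ A ∨ Disjoint A (cycleSet h y) := by
  have key : ∀ x, h.SameCycle y x → (x ∈ A ↔ y ∈ A) := by
    rintro x ⟨k, rfl⟩
    have : ∀ k : ℤ, ∀ z, (h ^ k) z ∈ A ↔ z ∈ A := by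
      intro k
      induction k using Int.induction_on with
      | zero => simp
      | succ k ih => intro z; rw [zpow_add_one, Perm.mul_apply, ih, H]
      | pred k ih => intro z; rw [zpow_sub_one, Perm.mul_apply, ih, stable_inv H]
    exact this k y
  by_cases hy : y ∈ A
  · left
    intro x hx
    exact (key x (mem_cycleSet.1 hx)).2 hy
  · right
    rw [disjoint_right]
    intro x hx hxA
    exact hy ((key x (mem_cycleSet.1 hx)).1 hxA)

/-- A cycle of length l contributes (-1)^l from the cardinality and -(-1)^l from the sign, hence -1
whatever l is. -/
theorem neg_one_pow_mul_signOn_union_cycleSet {A : Finset α} {h : Perm α}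
    (H : ∀ x, h x ∈ A ↔ x ∈ A) {y : α} (hd : Disjoint A (cycleSet h y)) :
    (-1) ^ #(A ∪ cycleSet h y) * signOn (A ∪ cycleSet h y) h = -((-1) ^ #A * signOn A h) := by
  rw [card_union_of_disjoint hd, signOn_union hd H (stable_cycleSet h y), signOn_cycleSet, pow_add]
  have : ((-1 : ℤ) ^ #(cycleSet h y)) * (-1) ^ #(cycleSet h y) = 1 := by
    rw [← mul_pow]; simp
  linear_combination (-(-1) ^ #A * signOn A h) * this

/-- Toggling one cycle is a sign-reversing involution on stable sets, and it keeps unstable sets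
unstable. -/
theorem neg_one_pow_mul_signOn_symmDiff_cycleSet (A : Finset α) (h : Perm α) (y : α) :
    (-1) ^ #(symmDiff A (cycleSet h y)) * signOn (symmDiff A (cycleSet h y)) h =
      -((-1) ^ #A * signOn A h) := by
  have stab : ∀ {A : Finset α}, (∀ x, h x ∈ A ↔ x ∈ A) →
      ∀ x, h x ∈ symmDiff A (cycleSet h y) ↔ x ∈ symmDiff A (cycleSet h y) := by
    intro A H x
    simp [mem_symmDiff, H, stable_cycleSet h y x]
  by_cases H : ∀ x, h x ∈ A ↔ x ∈ A
  · rcases stable_cycleSet_subset_or_disjoint H y with hs | hd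
    · have e : A = symmDiff A (cycleSet h y) ∪ cycleSet h y := by
        ext x
        have := @hs x
        simp only [mem_union, mem_symmDiff]
        tauto
      have hd : Disjoint (symmDiff A (cycleSet h y)) (cycleSet h y) := by
        rw [disjoint_left]
        intro x hx hx'
        have := hs hx'
        simp only [mem_symmDiff] at hx
        tauto
      have := neg_one_pow_mul_signOn_union_cycleSet (stab H) hd
      rw [← e] at this
      rw [this, neg_neg]
    · have e : symmDiff A (cycleSet h y) = A ∪ cycleSet h y := hd.symmDiff_eq_sup
      rw [e]
      exact neg_one_pow_mul_signOn_union_cycleSet H hd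
  · have H' : ¬ ∀ x, h x ∈ symmDiff A (cycleSet h y) ↔ x ∈ symmDiff A (cycleSet h y) := by
      intro H'
      have := stab H'
      rw [symmDiff_symmDiff_cancel_right] at this
      exact H this
    rw [signOn_of_not_stable H, signOn_of_not_stable H']
    simp

theorem sum_eq_zero_of_symmDiff_cycleSet (h : Perm α) (y : α) (p : Finset α → Prop)
    [DecidablePred p] (hp : ∀ A, p (symmDiff A (cycleSet h y)) ↔ p A) :
    ∑ A with p A, (-1) ^ #A * signOn A h = 0 := by
  have e : ∑ A with p A, (-1) ^ #A * signOn A h = ∑ A with p A, -((-1) ^ #A * signOn A h) := by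
    refine sum_nbij' (fun A => symmDiff A (cycleSet h y)) (fun A => symmDiff A (cycleSet h y))
      ?_ ?_ ?_ ?_ ?_
    · intro A hA
      simpa [hp] using hA
    · intro A hA
      simpa [hp] using hA
    · intro A _
      exact symmDiff_symmDiff_cancel_right _ _
    · intro A _
      exact symmDiff_symmDiff_cancel_right _ _
    · intro A _
      rw [neg_one_pow_mul_signOn_symmDiff_cycleSet, neg_neg]
  rw [sum_neg_distrib] at e
  omega

theorem sum_signOn_eq_zero [Nonempty α] (h : Perm α) :
    ∑ A : Finset α, (-1) ^ #A * signOn A h = 0 := by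
  have := sum_eq_zero_of_symmDiff_cycleSet h (Classical.arbitrary α) (fun _ => True) (by simp)
  simpa using this

/-- If some cycle misses x, toggling it cancels everything. Otherwise the only stable set containing
x is the whole type. -/
theorem sum_signOn_mem (h : Perm α) (x : α) :
    ∑ A with x ∈ A, (-1) ^ #A * signOn A h = if ∀ a b, h.SameCycle a b then -1 else 0 := by
  split_ifs with hc
  · rw [sum_eq_single univ]
    · have hx : cycleSet h x = univ := by
        ext a; simp [mem_cycleSet, hc]
      have := signOn_cycleSet h x
      rw [hx] at this
      rw [this, mul_neg, ← mul_pow]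
      simp
    · intro A hA hne
      rw [signOn_of_not_stable, mul_zero]
      intro H
      rw [mem_filter] at hA
      apply hne
      rcases stable_cycleSet_subset_or_disjoint H x with hs | hd
      · rw [eq_univ_iff_forall]
        exact fun a => hs (mem_cycleSet.2 (hc _ _))
      · exact (disjoint_left.1 hd hA.2 (mem_cycleSet.2 (hc _ _))).elim
    · simp
  · obtain ⟨y, hy⟩ : ∃ y, ¬ h.SameCycle y x := by
      by_contra! hall
      exact hc fun a b => (hall a).trans (hall b).symm
    apply sum_eq_zero_of_symmDiff_cycleSet h y
    intro A
    have : x ∉ cycleSet h y := fun h' => hy (mem_cycleSet.1 h')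
    simp [mem_symmDiff, this]

/-- This is t d/dt of det(1 + t h) at t = -1, obtained by writing |A| as a sum over the points of A.
-/
theorem sum_card_mul_signOn (h : Perm α) :
    ∑ A : Finset α, (#A : ℤ) * ((-1) ^ #A * signOn A h) =
      if ∀ a b, h.SameCycle a b then -(Fintype.card α : ℤ) else 0 := by
  have : ∀ A : Finset α, (#A : ℤ) * ((-1) ^ #A * signOn A h) =
      ∑ x : α, if x ∈ A then (-1) ^ #A * signOn A h else 0 := by
    intro A
    rw [sum_ite_mem, univ_inter, sum_const, nsmul_eq_mul]
  simp_rw [this]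
  rw [sum_comm]
  simp_rw [← sum_filter, sum_signOn_mem]
  split_ifs <;> simp

/-- Two points are needed because `cycleType` ignores fixed points: on one point the identity has
empty cycle type. -/
theorem sameCycle_iff_cycleType (hα : 2 ≤ Fintype.card α) (h : Perm α) :
    (∀ a b, h.SameCycle a b) ↔ h.cycleType = {Fintype.card α} := by
  constructor
  · intro hc
    have : Nontrivial α := Fintype.one_lt_card_iff_nontrivial.1 hα
    have hm : ∀ x, h x ≠ x := by
      intro x hx
      obtain ⟨y, hy⟩ := exists_ne x
      exact hy ((hc x y).eq_of_left hx).symm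
    have hcyc : h.IsCycle := by
      obtain ⟨x⟩ : Nonempty α := inferInstance
      exact ⟨x, hm x, fun y _ => hc x y⟩
    have hs : h.support = univ := by
      ext x; simp [hm x]
    rw [hcyc.cycleType, hs, card_univ]
  · intro hct
    have hcyc : h.IsCycle := by
      rw [← Perm.card_cycleType_eq_one, hct, Multiset.card_singleton]
    have hs : h.support = univ := by
      rw [hcyc.cycleType, Multiset.singleton_inj] at hct
      exact (card_eq_iff_eq_univ _).1 hct
    intro a b
    have hm : ∀ x, h x ≠ x := fun x => Perm.mem_support.1 (hs ▸ mem_univ x)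
    exact hcyc.sameCycle (hm a) (hm b)

theorem sum_card_mul_signOn_mul_classFunction (hα : 2 ≤ Fintype.card α) (φ : Perm α → ℂ)
    (hφ : ∀ g h, IsConj g h → φ g = φ h) (w : Perm α) (hw : w.cycleType = {Fintype.card α}) :
    ∑ A : Finset α, (#A : ℂ) * ((-1) ^ #A * ∑ h, (signOn A h : ℂ) * φ h) =
      -((Fintype.card α).factorial * φ w) := by
  have e : ∑ A : Finset α, (#A : ℂ) * ((-1) ^ #A * ∑ h, (signOn A h : ℂ) * φ h) =
      ∑ h, ((∑ A : Finset α, (#A : ℤ) * ((-1) ^ #A * signOn A h) : ℤ) : ℂ) * φ h := by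
    simp_rw [mul_sum]
    rw [sum_comm]
    refine sum_congr rfl fun h _ => ?_
    push_cast
    rw [sum_mul]
    refine sum_congr rfl fun A _ => ?_
    ring
  rw [e]
  simp_rw [sum_card_mul_signOn, sameCycle_iff_cycleType hα]
  have e2 : ∀ h : Perm α, (((if h.cycleType = {Fintype.card α} then -(Fintype.card α : ℤ) else 0
      : ℤ)) : ℂ) * φ h = if h.cycleType = {Fintype.card α} then -(Fintype.card α : ℂ) * φ w
      else 0 := by
    intro h
    split_ifs with hh
    · rw [hφ h w (Perm.isConj_iff_cycleType_eq.2 (hh.trans hw.symm))]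
      push_cast
      ring
    · simp
  simp_rw [e2]
  -- There are (N-1)! full cycles, each with weight -N, which produces -N!.
  rw [← sum_filter, sum_const, Perm.card_of_cycleType_singleton hα le_rfl, Nat.choose_self,
    mul_one, nsmul_eq_mul, ← Nat.mul_factorial_pred (show Fintype.card α ≠ 0 by omega)]
  push_cast
  ring

theorem sum_signOn_mul_function [Nonempty α] (φ : Perm α → ℂ) :
    ∑ A : Finset α, ((-1) ^ #A * ∑ h, (signOn A h : ℂ) * φ h) = 0 := by
  have e : ∑ A : Finset α, ((-1) ^ #A * ∑ h, (signOn A h : ℂ) * φ h) =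
      ∑ h, ((∑ A : Finset α, ((-1) ^ #A * signOn A h) : ℤ) : ℂ) * φ h := by
    simp_rw [mul_sum]
    rw [sum_comm]
    refine sum_congr rfl fun h _ => ?_
    push_cast
    rw [sum_mul]
    refine sum_congr rfl fun A _ => ?_
    ring
  rw [e]
  simp_rw [sum_signOn_eq_zero]
  simp

theorem card_stable (A : Finset α) :
    #{h : Perm α | ∀ x, h x ∈ A ↔ x ∈ A} = (#A).factorial * (Fintype.card α - #A).factorial := by
  have := DomMulAct.stabilizer_card (fun x : α => (decide (x ∈ A) : Bool))
  rw [Fintype.prod_bool] at this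
  have h1 : Fintype.card {a // decide (a ∈ A) = true} = #A := by
    rw [Fintype.card_subtype]; simp
  have h2 : Fintype.card {a // decide (a ∈ A) = false} = Fintype.card α - #A := by
    rw [Fintype.card_subtype, ← card_compl]; congr 1; ext; simp
  rw [h1, h2] at this
  rw [← this, Fintype.card_subtype]
  congr 1
  ext h
  simp [funext_iff]

end SignOn

/-! ### From multiplicities of sign characters to the character value at a full cycle -/

section SignInvariants

open Equiv Finset

variable {α : Type*} [Fintype α] [DecidableEq α] {V : Type*} [AddCommGroup V] [Module ℂ V]

/-- There is a nonzero vector on which the permutations `h` preserving `A` act through the sign of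
their restriction to `A`. -/
def HasSignInvariant (ρ : Representation ℂ (Perm α) V) (A : Finset α) : Prop :=
  ∃ v : V, v ≠ 0 ∧ ∀ h : Perm α, (∀ x, h x ∈ A ↔ x ∈ A) → (signOn A h : ℂ) • ρ h v = v

theorem HasSignInvariant.of_equiv {W : Type*} [AddCommGroup W] [Module ℂ W]
    {ρ : Representation ℂ (Perm α) V} {σ : Representation ℂ (Perm α) W} (f : V ≃ₗ[ℂ] W)
    (hf : ∀ g v, f (ρ g v) = σ g (f v)) {A : Finset α} (h : HasSignInvariant ρ A) :
    HasSignInvariant σ A := by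
  obtain ⟨v, hv, hh⟩ := h
  refine ⟨f v, by simpa using hv, fun g hg => ?_⟩
  rw [← hf, ← map_smul, hh g hg]

/-- The permutations preserving the set `A`. -/
def setStabilizer (A : Finset α) : Subgroup (Perm α) where
  carrier := {h | ∀ x, h x ∈ A ↔ x ∈ A}
  mul_mem' {g h} hg hh x := by
    rw [Perm.mul_apply, hg, hh]
  one_mem' x := Iff.rfl
  inv_mem' {h} hh := stable_inv hh

/-- The restriction of `ρ` to the stabilizer of `A`, twisted by the sign of the action on `A`. -/
def signTwist (ρ : Representation ℂ (Perm α) V) (A : Finset α) :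
    Representation ℂ (setStabilizer A) V where
  toFun h := (signOn A (h : Perm α) : ℂ) • ρ h
  map_one' := by simp [signOn_one]
  map_mul' g h := by
    rw [Subgroup.coe_mul, signOn_mul g.2 h.2, map_mul, Int.cast_mul]
    rw [smul_mul_smul_comm]

/-- The sum is the stabilizer order times the dimension of the invariants of `signTwist ρ A`, by
averaging over the stabilizer; `signOn` vanishes off it. -/
theorem sum_signOn_mul_character [FiniteDimensional ℂ V] (ρ : Representation ℂ (Perm α) V)
    (A : Finset α) :
    ∃ m : ℕ, ∑ h, (signOn A h : ℂ) * ρ.character h =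
        (#{h : Perm α | ∀ x, h x ∈ A ↔ x ∈ A} : ℂ) * m ∧ (m ≠ 0 ↔ HasSignInvariant ρ A) := by
  classical
  refine ⟨Module.finrank ℂ (signTwist ρ A).invariants, ?_, ?_⟩
  · have hne : (Nat.card (setStabilizer A) : ℂ) ≠ 0 := by
      exact_mod_cast Nat.card_pos.ne'
    have := invertibleOfNonzero hne
    have key := (signTwist ρ A).card_inv_mul_sum_char_eq_finrank
    rw [inv_mul_eq_iff_eq_mul₀ hne] at key
    have hc : Nat.card (setStabilizer A) = #{h : Perm α | ∀ x, h x ∈ A ↔ x ∈ A} := by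
      rw [Nat.card_eq_fintype_card]
      exact Fintype.card_of_subtype _ fun h => by simp; rfl
    rw [← hc, ← key]
    have hs : ∑ h, (signOn A h : ℂ) * ρ.character h =
        ∑ h with ∀ x, h x ∈ A ↔ x ∈ A, (signOn A h : ℂ) * ρ.character h := by
      symm
      apply sum_subset (filter_subset _ _)
      intro h _ hh
      rw [signOn_of_not_stable (by simpa using hh)]
      simp
    rw [hs, sum_subtype (p := (· ∈ setStabilizer A)) _ (fun h => by simp; rfl)]
    refine sum_congr rfl fun h _ => ?_
    simp [Representation.character, signTwist]
  · rw [← Nat.pos_iff_ne_zero, Module.finrank_pos_iff_exists_ne_zero]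
    constructor
    · rintro ⟨⟨v, hv⟩, hne⟩
      refine ⟨v, by simpa using hne, fun h hh => ?_⟩
      exact (Representation.mem_invariants _ v).1 hv ⟨h, hh⟩
    · rintro ⟨v, hne, hv⟩
      exact ⟨⟨v, (Representation.mem_invariants _ v).2 fun h => hv h.1 h.2⟩, by simpa using hne⟩

/-- With P and Q the weighted multiplicities in sizes i and i+1, the two alternating sums give P = Q
and N! χ(w) = (-1)^i P. -/
theorem character_cycle_of_hasSignInvariant [FiniteDimensional ℂ V]
    (hα : 2 ≤ Fintype.card α) (ρ : Representation ℂ (Perm α) V) (w : Perm α)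
    (hw : w.cycleType = {Fintype.card α}) {i : ℕ} (hi : i ≤ Fintype.card α)
    (honly : ∀ A, HasSignInvariant ρ A → #A = i ∨ #A = i + 1)
    (hall : ∀ A, #A = i → HasSignInvariant ρ A) :
    ∃ r : ℝ, 1 ≤ r ∧ ρ.character w = (-1) ^ i * r := by
  have : Nonempty α := Fintype.card_pos_iff.1 (by omega)
  choose m hm hm0 using sum_signOn_mul_character ρ
  set s : Finset α → ℕ := fun A => #{h : Perm α | ∀ x, h x ∈ A ↔ x ∈ A} * m A with hs
  have e0 := sum_signOn_mul_function ρ.character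
  have e1 := sum_card_mul_signOn_mul_classFunction hα ρ.character (by
    intro g h hgh
    obtain ⟨c, rfl⟩ := isConj_iff.1 hgh
    simp) w hw
  have hms : ∀ A, ∑ h, (signOn A h : ℂ) * ρ.character h = s A := by
    intro A
    rw [hm, hs]
    push_cast
    rfl
  simp_rw [hms] at e0 e1
  have split : ∀ F : Finset α → ℂ, (∀ A, s A = 0 → F A = 0) →
      ∑ A, F A = ∑ A with #A = i, F A + ∑ A with #A = i + 1, F A := by
    intro F hF
    rw [← sum_union (by
      rw [disjoint_filter]
      intro A _ h1 h2
      omega), ← filter_or]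
    symm
    apply sum_subset (filter_subset _ _)
    intro A _ hA
    apply hF
    have hmA : m A = 0 := by
      by_contra hne
      exact hA (by simpa using honly A ((hm0 A).1 hne))
    simp [hs, hmA]
  rw [split _ (by intro A hA; simp [hA])] at e0 e1
  have c : ∀ (k : ℕ) (a : ℕ → ℂ), ∑ A : Finset α with #A = k, a #A * (s A : ℂ) =
      a k * ((∑ A with #A = k, s A : ℕ) : ℂ) := by
    intro k a
    push_cast
    rw [mul_sum]
    exact sum_congr rfl fun A hA => by rw [(mem_filter.1 hA).2]
  rw [c i (fun k => (-1) ^ k), c (i + 1) (fun k => (-1) ^ k)] at e0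
  simp_rw [← mul_assoc] at e1
  rw [c i (fun k => k * (-1) ^ k), c (i + 1) (fun k => k * (-1) ^ k)] at e1
  -- Each of the C(N,i) sets contributes at least its stabilizer order i!(N-i)!.
  have hge : (Fintype.card α).factorial ≤ ∑ A with #A = i, s A := by
    calc (Fintype.card α).factorial
        = ∑ A : Finset α with #A = i, i.factorial * (Fintype.card α - i).factorial := by
          have : #{A : Finset α | #A = i} = (Fintype.card α).choose i := by
            rw [univ_filter_card_eq, card_powersetCard, card_univ]
          rw [sum_const, this, smul_eq_mul, ← mul_assoc,
            Nat.choose_mul_factorial_mul_factorial hi]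
      _ ≤ ∑ A with #A = i, s A := by
          refine sum_le_sum fun A hA => ?_
          have hA := (mem_filter.1 hA).2
          have : m A ≠ 0 := (hm0 A).2 (hall A hA)
          simp only [hs]
          rw [card_stable, hA]
          exact Nat.le_mul_of_pos_right _ (Nat.pos_of_ne_zero this)
  generalize (∑ A with #A = i, s A : ℕ) = P at *
  generalize (∑ A with #A = i + 1, s A : ℕ) = Q at *
  have hfac : ((Fintype.card α).factorial : ℂ) ≠ 0 := by
    exact_mod_cast Nat.factorial_ne_zero _
  refine ⟨P / (Fintype.card α).factorial, ?_, ?_⟩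
  · rw [one_le_div (by positivity)]
    exact_mod_cast hge
  · push_cast
    rw [← mul_div_assoc, eq_div_iff hfac]
    push_cast [pow_succ] at e0 e1
    -- The factor i+1 is the one that eliminates Q.
    linear_combination e1 - (i + 1 : ℂ) * e0

end SignInvariants

/-! ### Unitarity of characters and Bessel's inequality -/

section Bessel

open Finset ComplexConjugate

/-- Unitary trick: the averaged form H = Σ M(g)ᴴ M(g) is invariant and positive definite, so M(g)ᴴ
is conjugate to M(g⁻¹) through H. -/
theorem Representation.character_inv_eq_conj {G V : Type*} [Group G] [Fintype G] [AddCommGroup V]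
    [Module ℂ V] [FiniteDimensional ℂ V] (ρ : Representation ℂ G V) (g : G) :
    ρ.character g⁻¹ = conj (ρ.character g) := by
  classical
  open scoped ComplexOrder Matrix in
  let b := Module.finBasis ℂ V
  let M : G → Matrix (Fin (Module.finrank ℂ V)) (Fin (Module.finrank ℂ V)) ℂ :=
    fun g => LinearMap.toMatrix b b (ρ g)
  have hM : ∀ g h, M (g * h) = M g * M h := fun g h => by
    simp only [M, map_mul, LinearMap.toMatrix_mul]
  have hM1 : M 1 = 1 := by simp [M]
  have hχ : ∀ g, ρ.character g = (M g).trace := fun g => by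
    simp only [M, Representation.character]
    exact LinearMap.trace_eq_matrix_trace ℂ b _
  let H := ∑ g : G, (M g)ᴴ * M g
  have hpd : H.PosDef := by
    have h1 : ∀ g, ((M g)ᴴ * M g).PosSemidef := fun g => Matrix.posSemidef_conjTranspose_mul_self _
    -- The term of the identity alone makes the sum definite; the others are only semidefinite.
    have : H = (M 1)ᴴ * M 1 + ∑ g ∈ univ.erase (1 : G), (M g)ᴴ * M g :=
      (add_sum_erase univ (fun g => (M g)ᴴ * M g) (mem_univ 1)).symm
    rw [this, hM1]
    refine Matrix.PosDef.add_posSemidef (by simpa using Matrix.PosDef.one) ?_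
    exact Matrix.posSemidef_sum _ fun g _ => h1 g
  have hdet : IsUnit H.det := (Matrix.isUnit_iff_isUnit_det _).1 hpd.isUnit
  have hinv : (M g)ᴴ * H * M g = H := by
    simp only [H, mul_sum, sum_mul]
    refine Fintype.sum_equiv (Equiv.mulRight g) _ _ fun k => ?_
    simp [hM, Matrix.conjTranspose_mul, Matrix.mul_assoc]
  have hinv2 : M g * M g⁻¹ = 1 := by rw [← hM, mul_inv_cancel, hM1]
  have h2 : (M g)ᴴ = H * M g⁻¹ * H⁻¹ := by
    have : (M g)ᴴ * H = H * M g⁻¹ := by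
      calc (M g)ᴴ * H = (M g)ᴴ * H * (M g * M g⁻¹) := by rw [hinv2, mul_one]
        _ = (M g)ᴴ * H * M g * M g⁻¹ := by rw [mul_assoc _ (M g)]
        _ = _ := by rw [hinv]
    rw [← this, mul_assoc, Matrix.mul_nonsing_inv _ hdet, mul_one]
  have h3 : conj ((M g).trace) = ((M g)ᴴ).trace := by
    rw [Matrix.trace_conjTranspose]
    rfl
  rw [hχ, hχ, h3, h2, Matrix.trace_mul_comm, ← mul_assoc, Matrix.nonsing_inv_mul _ hdet, one_mul]

/-- Bessel's inequality for the indicator of the class S of w against the family χ_i/√|G| gives Σ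
|χ_i(w)|² ≤ |G|/|S|. -/
theorem sum_norm_sq_character_le {G ι : Type*} [Group G] [Fintype G] [Fintype ι] [DecidableEq ι]
    (χ : ι → G → ℂ) (hclass : ∀ i g h, IsConj g h → χ i g = χ i h)
    (horth : ∀ i j, ∑ g, χ i g * conj (χ j g) = if i = j then (Fintype.card G : ℂ) else 0)
    (w : G) (K : ℕ) (S : Finset G) (hS : ∀ g, g ∈ S ↔ IsConj w g) (hK : Fintype.card G ≤ K * #S) :
    ∑ i, ‖χ i w‖ ^ 2 ≤ K := by
  classical
  have hG : (0 : ℝ) < Fintype.card G := by exact_mod_cast Fintype.card_pos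
  have hSpos : (0 : ℝ) < #S := by
    exact_mod_cast card_pos.2 ⟨w, (hS w).2 (IsConj.refl w)⟩
  let c : ℝ := (Real.sqrt (Fintype.card G))⁻¹
  have hc : c * c * Fintype.card G = 1 := by
    simp only [c]
    rw [← mul_inv, Real.mul_self_sqrt hG.le, inv_mul_cancel₀ hG.ne']
  let v : ι → EuclideanSpace ℂ G := fun i => WithLp.toLp 2 fun g => c * χ i g
  let δ : EuclideanSpace ℂ G := WithLp.toLp 2 fun g => if g ∈ S then 1 else 0
  have hv : Orthonormal ℂ v := by
    rw [orthonormal_iff_ite]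
    intro i j
    have : inner ℂ (v i) (v j) = (c : ℂ) * c * ∑ g, χ j g * conj (χ i g) := by
      rw [mul_sum, PiLp.inner_apply]
      refine sum_congr rfl fun g _ => ?_
      simp only [v, RCLike.inner_apply, map_mul, Complex.conj_ofReal]
      ring
    rw [this, horth]
    simp only [eq_comm (a := j)]
    split_ifs
    · exact_mod_cast hc
    · simp
  have hb := hv.sum_inner_products_le (s := univ) δ
  have hδ : ‖δ‖ ^ 2 = #S := by
    rw [EuclideanSpace.norm_sq_eq]
    simp only [δ]
    simp_rw [apply_ite (fun z : ℂ => ‖z‖ ^ 2)]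
    simp
  have hi : ∀ i, ‖inner ℂ (v i) δ‖ ^ 2 = (#S : ℝ) ^ 2 * (c * c) * ‖χ i w‖ ^ 2 := by
    intro i
    have : inner ℂ (v i) δ = #S * c * conj (χ i w) := by
      rw [PiLp.inner_apply]
      simp only [v, δ, RCLike.inner_apply, map_mul, Complex.conj_ofReal, ite_mul, one_mul, zero_mul]
      rw [← sum_filter, sum_congr rfl (g := fun _ => (c : ℂ) * conj (χ i w))]
      · simp [mul_assoc]
      · intro g hg
        simp only [mem_filter, mem_univ, true_and] at hg
        rw [hclass i w g ((hS g).1 hg)]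
    rw [this]
    simp only [norm_mul, RCLike.norm_conj, mul_pow, Complex.norm_natCast, Complex.norm_real,
      Real.norm_eq_abs, sq_abs]
    ring
  simp_rw [hi, hδ, ← mul_sum] at hb
  have hK' : (Fintype.card G : ℝ) ≤ K * #S := by exact_mod_cast hK
  have hT : 0 ≤ ∑ i, ‖χ i w‖ ^ 2 := sum_nonneg fun _ _ => by positivity
  set T := ∑ i, ‖χ i w‖ ^ 2
  have h1 : (#S : ℝ) * T ≤ Fintype.card G := by
    have : (#S : ℝ) * ((#S : ℝ) * T) ≤ #S * Fintype.card G := by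
      calc (#S : ℝ) * ((#S : ℝ) * T)
          = ((#S : ℝ) ^ 2 * (c * c) * T) * Fintype.card G := by
            linear_combination (-(#S : ℝ) ^ 2 * T) * hc
        _ ≤ _ := mul_le_mul_of_nonneg_right hb hG.le
    exact le_of_mul_le_mul_left this hSpos
  have h2 : (#S : ℝ) * T ≤ #S * K := by linarith
  exact le_of_mul_le_mul_left h2 hSpos

end Bessel

/-! ### Signed column sums and irreducibility of Specht modules -/

section Polytabloids

open Equiv Finset

variable {n : ℕ} {μ : YoungDiagram}

theorem rowFillingRep_single (g : Perm (Fin n)) (f : Fin n → ℕ) (a : ℂ) :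
    rowFillingRep n g (Finsupp.single f a) = Finsupp.single (f ∘ ⇑g⁻¹) a := by
  simp [rowFillingRep]

theorem rowFillingRep_apply (g : Perm (Fin n)) (v : (Fin n → ℕ) →₀ ℂ) (f : Fin n → ℕ) :
    rowFillingRep n g v f = v (f ∘ g) := by
  have hinj : Function.Injective fun f : Fin n → ℕ => f ∘ ⇑g⁻¹ := fun a b hab =>
    (g⁻¹).surjective.injective_comp_right hab
  have : f = (fun f : Fin n → ℕ => f ∘ ⇑g⁻¹) (f ∘ g) := by
    funext k
    simp
  conv_lhs => rw [this]
  exact Finsupp.mapDomain_apply hinj v _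

namespace YTableau

theorem ext_rowOf_colOf (t : YTableau n μ) {k l : Fin n} (hr : t.rowOf k = t.rowOf l)
    (hc : t.colOf k = t.colOf l) : k = l :=
  t.injective (Subtype.ext (Prod.ext hr hc))

theorem mem_cells (t : YTableau n μ) (k : Fin n) : (t.rowOf k, t.colOf k) ∈ μ.cells := (t k).2

theorem exists_rowOf_colOf (t : YTableau n μ) {r c : ℕ} (h : (r, c) ∈ μ.cells) :
    ∃ k, t.rowOf k = r ∧ t.colOf k = c :=
  ⟨t.symm ⟨(r, c), h⟩, by simp [rowOf], by simp [colOf]⟩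

/-- The permutations preserving every column of `t`. -/
def columnStabilizer (t : YTableau n μ) : Finset (Perm (Fin n)) :=
  univ.filter fun q => t.colOf ∘ ⇑q = t.colOf

theorem mem_columnStabilizer {t : YTableau n μ} {q : Perm (Fin n)} :
    q ∈ t.columnStabilizer ↔ ∀ k, t.colOf (q k) = t.colOf k := by
  simp [columnStabilizer, funext_iff]

theorem one_mem_columnStabilizer (t : YTableau n μ) : 1 ∈ t.columnStabilizer := by
  simp [mem_columnStabilizer]

theorem mul_mem_columnStabilizer {t : YTableau n μ} {p q : Perm (Fin n)}
    (hp : p ∈ t.columnStabilizer) (hq : q ∈ t.columnStabilizer) : p * q ∈ t.columnStabilizer := by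
  rw [mem_columnStabilizer] at *
  simp [hp, hq]

theorem inv_mem_columnStabilizer {t : YTableau n μ} {q : Perm (Fin n)}
    (hq : q ∈ t.columnStabilizer) : q⁻¹ ∈ t.columnStabilizer := by
  rw [mem_columnStabilizer] at *
  intro k
  rw [← hq (q⁻¹ k)]
  simp

theorem swap_mem_columnStabilizer {t : YTableau n μ} {a b : Fin n} (h : t.colOf a = t.colOf b) :
    swap a b ∈ t.columnStabilizer := by
  rw [mem_columnStabilizer]
  intro k
  rw [swap_apply_def]
  split_ifs with h1 h2
  · rw [h1, h]
  · rw [h2, h]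
  · rfl

/-- The signed column sum of `t`, acting on a representation. -/
noncomputable def columnSum (t : YTableau n μ) {V : Type*} [AddCommGroup V] [Module ℂ V]
    (ρ : Representation ℂ (Perm (Fin n)) V) : V →ₗ[ℂ] V :=
  ∑ q ∈ t.columnStabilizer, (((Perm.sign q : ℤˣ) : ℤ) : ℂ) • ρ q

section columnSum

variable {V : Type*} [AddCommGroup V] [Module ℂ V] (ρ : Representation ℂ (Perm (Fin n)) V)

theorem columnSum_apply (t : YTableau n μ) (v : V) :
    t.columnSum ρ v = ∑ q ∈ t.columnStabilizer, (((Perm.sign q : ℤˣ) : ℤ) : ℂ) • ρ q v := by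
  simp [columnSum]

theorem columnSum_apply_of_mem {t : YTableau n μ} {p : Perm (Fin n)} (hp : p ∈ t.columnStabilizer)
    (v : V) : t.columnSum ρ (ρ p v) = (((Perm.sign p : ℤˣ) : ℤ) : ℂ) • t.columnSum ρ v := by
  rw [columnSum_apply, columnSum_apply, smul_sum]
  refine sum_nbij' (fun q => q * p) (fun q => q * p⁻¹) ?_ ?_ ?_ ?_ ?_
  · exact fun q hq => mul_mem_columnStabilizer hq hp
  · exact fun q hq => mul_mem_columnStabilizer hq (inv_mem_columnStabilizer hp)
  · intro q _
    simp
  · intro q _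
    simp
  · intro q _
    rw [smul_smul, Perm.sign_mul, map_mul, Module.End.mul_apply, mul_comm (Perm.sign q),
      Units.val_mul, Int.cast_mul, ← mul_assoc, ← Int.cast_mul, ← Units.val_mul,
      Int.units_mul_self]
    simp

theorem apply_columnSum_of_mem {t : YTableau n μ} {p : Perm (Fin n)} (hp : p ∈ t.columnStabilizer)
    (v : V) : ρ p (t.columnSum ρ v) = (((Perm.sign p : ℤˣ) : ℤ) : ℂ) • t.columnSum ρ v := by
  rw [columnSum_apply, map_sum, smul_sum]
  refine sum_nbij' (fun q => p * q) (fun q => p⁻¹ * q) ?_ ?_ ?_ ?_ ?_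
  · exact fun q hq => mul_mem_columnStabilizer hp hq
  · exact fun q hq => mul_mem_columnStabilizer (inv_mem_columnStabilizer hp) hq
  · intro q _
    simp
  · intro q _
    simp
  · intro q _
    rw [smul_smul, map_smul, Perm.sign_mul, map_mul, Module.End.mul_apply,
      Units.val_mul, Int.cast_mul, ← mul_assoc, ← Int.cast_mul, ← Units.val_mul,
      Int.units_mul_self]
    simp

end columnSum

theorem polytabloid_eq_columnSum (t : YTableau n μ) :
    t.polytabloid = t.columnSum (rowFillingRep n) (Finsupp.single t.rowOf 1) := by
  rw [columnSum_apply]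
  refine sum_congr rfl fun q _ => ?_
  rw [rowFillingRep_single, Finsupp.smul_single, smul_eq_mul, mul_one]

theorem rowFillingRep_polytabloid_of_mem {t : YTableau n μ} {p : Perm (Fin n)}
    (hp : p ∈ t.columnStabilizer) :
    rowFillingRep n p t.polytabloid = (((Perm.sign p : ℤˣ) : ℤ) : ℂ) • t.polytabloid := by
  rw [polytabloid_eq_columnSum, apply_columnSum_of_mem _ hp]

theorem columnSum_polytabloid (t : YTableau n μ) :
    t.columnSum (rowFillingRep n) t.polytabloid = (#t.columnStabilizer : ℂ) • t.polytabloid := by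
  rw [columnSum_apply, sum_congr rfl (g := fun _ => t.polytabloid), sum_const,
    ← Nat.cast_smul_eq_nsmul ℂ]
  intro q hq
  rw [rowFillingRep_polytabloid_of_mem hq, smul_smul, ← Int.cast_mul, ← Units.val_mul,
    Int.units_mul_self]
  simp

theorem polytabloid_apply (t : YTableau n μ) (f : Fin n → ℕ) :
    t.polytabloid f = ((∑ q ∈ t.columnStabilizer,
      if t.rowOf ∘ ⇑q⁻¹ = f then ((Perm.sign q : ℤˣ) : ℤ) else 0 : ℤ) : ℂ) := by
  rw [polytabloid, Finsupp.finsetSum_apply, Int.cast_sum]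
  refine sum_congr rfl fun q _ => ?_
  rw [Finsupp.single_apply]
  split_ifs <;> simp

/-- The tabloid of t has coefficient 1, since only the identity preserves both the rows and the
columns of t. -/
theorem polytabloid_ne_zero (t : YTableau n μ) : t.polytabloid ≠ 0 := by
  intro h
  have h1 := t.polytabloid_apply t.rowOf
  rw [h, Finsupp.zero_apply, sum_eq_single 1] at h1
  · simp at h1
  · intro q hq hne
    rw [if_neg]
    intro he
    apply hne
    rw [← inv_eq_one]
    ext k
    congr 1
    exact t.ext_rowOf_colOf (congrFun he k)
      (mem_columnStabilizer.1 (inv_mem_columnStabilizer hq) k)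
  · intro h
    exact absurd t.one_mem_columnStabilizer h

/-- The transposition of a and b fixes f but changes the sign of the column sum. -/
theorem columnSum_single_eq_zero (t : YTableau n μ) {f : Fin n → ℕ} {a b : Fin n} (hab : a ≠ b)
    (hc : t.colOf a = t.colOf b) (hf : f a = f b) :
    t.columnSum (rowFillingRep n) (Finsupp.single f 1) = 0 := by
  have h := columnSum_apply_of_mem (rowFillingRep n) (swap_mem_columnStabilizer hc)
    (Finsupp.single f 1)
  have hs : f ∘ ⇑(swap a b)⁻¹ = f := by
    funext k
    rw [swap_inv, Function.comp_apply, swap_apply_def]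
    split_ifs with h1 h2
    · rw [h1, hf]
    · rw [h2, hf]
    · rfl
  rw [rowFillingRep_single, hs, Perm.sign_swap hab] at h
  simpa [self_eq_neg] using h

/-- A row filling which is injective on the columns of `t` and stays in the shape is obtained from
that of `t` by a column permutation, so its signed column sum is a multiple of the polytabloid. -/
theorem columnSum_single_mem_span (t : YTableau n μ) {f : Fin n → ℕ}
    (hcell : ∀ k, (f k, t.colOf k) ∈ μ.cells)
    (hf : ∀ a b, t.colOf a = t.colOf b → f a = f b → a = b) :
    t.columnSum (rowFillingRep n) (Finsupp.single f 1) ∈ Submodule.span ℂ {t.polytabloid} := by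
  let p : Perm (Fin n) := Equiv.ofBijective (fun k => t.symm ⟨(f k, t.colOf k), hcell k⟩)
    (Finite.injective_iff_bijective.1 fun a b hab => by
      have := t.symm.injective hab
      simp only [Subtype.mk.injEq, Prod.mk.injEq] at this
      exact hf a b this.2 this.1)
  have hp : ∀ k, t (p k) = ⟨(f k, t.colOf k), hcell k⟩ := fun k => by simp [p]
  have hr : f = t.rowOf ∘ p := by
    funext k
    simp [rowOf, hp]
  have hpc : p⁻¹ ∈ t.columnStabilizer := by
    apply inv_mem_columnStabilizer
    rw [mem_columnStabilizer]
    intro k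
    simp [colOf, hp]
  have : Finsupp.single f (1 : ℂ) = rowFillingRep n p⁻¹ (Finsupp.single t.rowOf 1) := by
    rw [rowFillingRep_single, hr, inv_inv]
  rw [this, columnSum_apply_of_mem _ hpc, ← polytabloid_eq_columnSum]
  exact Submodule.smul_mem _ _ (Submodule.mem_span_singleton_self _)

theorem polytabloid_eq_rowFillingRep (t s : YTableau n μ) :
    ∃ g, s.polytabloid = rowFillingRep n g t.polytabloid := by
  refine ⟨(s.trans t.symm : Perm (Fin n))⁻¹, ?_⟩
  rw [rowFillingRep_polytabloid]
  congr 1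
  ext k : 1
  simp

end YTableau

/-- The inclusion of the Specht module into the space of row fillings. -/
noncomputable def SpechtModule.incl (n : ℕ) (μ : YoungDiagram) : SpechtModule n μ →ₗ[ℂ] (Fin n → ℕ) →₀ ℂ :=
  (specht n μ).toSubmodule.subtype

namespace SpechtModule

theorem incl_injective : Function.Injective (incl n μ) := Subtype.val_injective

theorem incl_mem (v : SpechtModule n μ) :
    incl n μ v ∈ Submodule.span ℂ (Set.range (YTableau.polytabloid (n := n) (μ := μ))) := v.2

theorem incl_spechtRep (g : Perm (Fin n)) (v : SpechtModule n μ) :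
    incl n μ (spechtRep n μ g v) = rowFillingRep n g (incl n μ v) := rfl

/-- The polytabloid as an element of the Specht module. -/
noncomputable def polytabloid (t : YTableau n μ) : SpechtModule n μ :=
  ⟨t.polytabloid, Submodule.subset_span ⟨t, rfl⟩⟩

@[simp]
theorem incl_polytabloid (t : YTableau n μ) : incl n μ (polytabloid t) = t.polytabloid := rfl

theorem incl_columnSum (t : YTableau n μ) (v : SpechtModule n μ) :
    incl n μ (t.columnSum (spechtRep n μ) v) = t.columnSum (rowFillingRep n) (incl n μ v) := by
  simp [YTableau.columnSum_apply, incl_spechtRep]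

theorem span_polytabloid :
    Submodule.span ℂ (Set.range (polytabloid (n := n) (μ := μ))) = ⊤ := by
  rw [eq_top_iff]
  intro v _
  have hv := incl_mem v
  have : Set.range (YTableau.polytabloid (n := n) (μ := μ)) =
      incl n μ '' Set.range polytabloid := by
    rw [← Set.range_comp]
    rfl
  rw [this, ← Submodule.map_span] at hv
  obtain ⟨u, hu, huv⟩ := hv
  rwa [← incl_injective huv]

theorem eq_top_of_polytabloid_mem (U : Subrepresentation (spechtRep n μ)) (t : YTableau n μ)
    (ht : polytabloid t ∈ U.toSubmodule) : U = ⊤ := by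
  apply Subrepresentation.toSubmodule_injective
  change U.toSubmodule = ⊤
  rw [eq_top_iff, ← span_polytabloid, Submodule.span_le]
  rintro _ ⟨s, rfl⟩
  obtain ⟨g, hg⟩ := t.polytabloid_eq_rowFillingRep s
  have : polytabloid s = spechtRep n μ g (polytabloid t) := incl_injective hg
  rw [this]
  exact U.apply_mem_toSubmodule g ht

theorem apply_ne_zero {v : SpechtModule n μ} {f : Fin n → ℕ} (hf : incl n μ v f ≠ 0) :
    ∃ s : YTableau n μ, f = s.rowOf := by
  by_contra! hs
  apply hf
  have hv := incl_mem v
  generalize incl n μ v = x at hv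
  induction hv using Submodule.span_induction with
  | mem x hx =>
    obtain ⟨s, rfl⟩ := hx
    rw [YTableau.polytabloid_apply, sum_eq_zero]
    · simp
    · intro q _
      rw [if_neg]
      intro h
      exact hs (Equiv.trans q⁻¹ s) h.symm
  | zero => rfl
  | add x y _ _ hx hy => rw [Finsupp.add_apply, hx, hy, add_zero]
  | smul a x _ hx => rw [Finsupp.smul_apply, hx, smul_zero]

/-- Tabloids with two entries of a column of t in one row are killed. The hypothesis makes every
other tabloid a column rearrangement of t. -/
theorem columnSum_mem_span (t : YTableau n μ)
    (h : ∀ s : YTableau n μ, (∀ a b, t.colOf a = t.colOf b → s.rowOf a = s.rowOf b → a = b) →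
      ∀ k, (s.rowOf k, t.colOf k) ∈ μ.cells) (v : SpechtModule n μ) :
    ∃ a : ℂ, t.columnSum (spechtRep n μ) v = a • polytabloid t := by
  have key : t.columnSum (rowFillingRep n) (incl n μ v) ∈ Submodule.span ℂ {t.polytabloid} := by
    rw [← Finsupp.sum_single (incl n μ v), Finsupp.sum, map_sum]
    refine Submodule.sum_mem _ fun f hf => ?_
    obtain ⟨s, rfl⟩ := apply_ne_zero (Finsupp.mem_support_iff.1 hf)
    rw [← mul_one (incl n μ v s.rowOf), ← smul_eq_mul, ← Finsupp.smul_single, map_smul]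
    apply Submodule.smul_mem
    by_cases hs : ∀ a b, t.colOf a = t.colOf b → s.rowOf a = s.rowOf b → a = b
    · exact t.columnSum_single_mem_span (h s hs) hs
    · push Not at hs
      obtain ⟨a, b, hc, hr, hab⟩ := hs
      rw [t.columnSum_single_eq_zero hab hc hr]
      exact Submodule.zero_mem _
  obtain ⟨a, ha⟩ := Submodule.mem_span_singleton.1 key
  refine ⟨a, incl_injective ?_⟩
  rw [incl_columnSum, map_smul, incl_polytabloid, ha]

theorem columnSum_mem (U : Subrepresentation (spechtRep n μ)) (t : YTableau n μ)
    {v : SpechtModule n μ} (hv : v ∈ U.toSubmodule) :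
    t.columnSum (spechtRep n μ) v ∈ U.toSubmodule := by
  rw [YTableau.columnSum_apply]
  exact Submodule.sum_mem _ fun q _ => Submodule.smul_mem _ _ (U.apply_mem_toSubmodule q hv)

/-- The column sum multiplies the generator `polytabloid t` by a nonzero number and maps the whole
module into its line. Of two complementary subrepresentations, one must therefore contain the
generator. -/
theorem isIrreducible (t : YTableau n μ)
    (h : ∀ s : YTableau n μ, (∀ a b, t.colOf a = t.colOf b → s.rowOf a = s.rowOf b → a = b) →
      ∀ k, (s.rowOf k, t.colOf k) ∈ μ.cells) : (spechtRep n μ).IsIrreducible := by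
  have hne : polytabloid t ≠ 0 := fun h0 =>
    t.polytabloid_ne_zero (by rw [← incl_polytabloid, h0, map_zero])
  have hnt : Nontrivial (Subrepresentation (spechtRep n μ)) := by
    refine ⟨⊥, ⊤, fun hbt => hne ?_⟩
    have : polytabloid t ∈ (⊥ : Subrepresentation (spechtRep n μ)).toSubmodule := by
      rw [hbt]
      exact Submodule.mem_top
    exact (Submodule.mem_bot ℂ).1 this
  refine { toNontrivial := hnt, eq_bot_or_eq_top := fun U => ?_ }
  -- Maschke's theorem.
  obtain ⟨W, hUW⟩ := exists_isCompl U
  have hsup : polytabloid t ∈ U.toSubmodule ⊔ W.toSubmodule := by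
    rw [← Subrepresentation.toSubmodule_sup, hUW.sup_eq_top]
    exact Submodule.mem_top
  obtain ⟨u, hu, w, hw, huw⟩ := Submodule.mem_sup.1 hsup
  obtain ⟨a, ha⟩ := columnSum_mem_span t h u
  obtain ⟨b, hb⟩ := columnSum_mem_span t h w
  have hmem : ∀ (U : Subrepresentation (spechtRep n μ)) (u : SpechtModule n μ) (a : ℂ),
      u ∈ U.toSubmodule → t.columnSum (spechtRep n μ) u = a • polytabloid t → a ≠ 0 → U = ⊤ := by
    intro U u a hu ha ha0
    apply eq_top_of_polytabloid_mem U t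
    rw [← Submodule.smul_mem_iff _ ha0, ← ha]
    exact columnSum_mem U t hu
  by_cases ha0 : a = 0
  · by_cases hb0 : b = 0
    · have h1 : t.columnSum (spechtRep n μ) (polytabloid t) = 0 := by
        rw [← huw, map_add, ha, hb, ha0, hb0]
        simp
      have h2 := congrArg (incl n μ) h1
      rw [incl_columnSum, incl_polytabloid, YTableau.columnSum_polytabloid, map_zero] at h2
      rcases smul_eq_zero.1 h2 with h3 | h3
      · exact absurd t.one_mem_columnStabilizer
          (by rw [card_eq_zero.1 (Nat.cast_eq_zero.1 h3)]; exact notMem_empty _)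
      · exact absurd h3 t.polytabloid_ne_zero
    · left
      have hW := hmem W w b hw hb hb0
      rw [hW] at hUW
      exact eq_bot_of_isCompl_top hUW
  · right
    exact hmem U u a hu ha ha0

end SpechtModule

end Polytabloids

/-! ### The near-hook shapes: irreducibility and tableaux -/

section LambdaPrimeShape

open Equiv Finset

variable {n i : ℕ}

theorem mem_lambdaPrimeShape {h : i + 3 ≤ n} (hi : 1 ≤ i) {r c : ℕ} :
    (r, c) ∈ (lambdaPrimeShape n i h).cells ↔
      (r = 0 ∧ c < n - i - 1) ∨ (r = 1 ∧ c < 2) ∨ (2 ≤ r ∧ r ≤ i ∧ c = 0) := by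
  rw [YoungDiagram.mem_cells, lambdaPrimeShape, YoungDiagram.mem_ofRowLens]
  match r with
  | 0 => simp
  | 1 => simp
  | r + 2 =>
    simp only [List.length_cons, List.length_replicate, List.getElem_cons_succ,
      List.getElem_replicate, exists_prop]
    omega

namespace YTableau

variable {h : i + 3 ≤ n} (t : YTableau n (lambdaPrimeShape n i h))

include t in
-- The first column of t has i+1 entries, so it meets each of the i+1 rows of s exactly once. An
-- entry outside it must then lie in a row of s with at least two cells, that is, row 0 or 1.
theorem lambdaPrimeShape_cells_of_injOn_columns (hi : 1 ≤ i)
    (s : YTableau n (lambdaPrimeShape n i h))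
    (hs : ∀ a b, t.colOf a = t.colOf b → s.rowOf a = s.rowOf b → a = b) (k : Fin n) :
    (s.rowOf k, t.colOf k) ∈ (lambdaPrimeShape n i h).cells := by
  have hsm := fun k => (mem_lambdaPrimeShape hi).1 (s.mem_cells k)
  have htm := fun k => (mem_lambdaPrimeShape hi).1 (t.mem_cells k)
  have hcol : ∀ j : Fin (i + 1), ∃ k, t.rowOf k = j ∧ t.colOf k = 0 := fun j =>
    t.exists_rowOf_colOf ((mem_lambdaPrimeShape hi).2 (by omega))
  choose e he1 he2 using hcol
  have hrow : ∀ k, s.rowOf k < i + 1 := fun k => by have := hsm k; omega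
  have hinj : Function.Injective fun j => (⟨s.rowOf (e j), hrow _⟩ : Fin (i + 1)) := by
    intro a b hab
    have hab' := hs (e a) (e b) (by rw [he2, he2]) (by simpa using hab)
    ext
    rw [← he1 a, ← he1 b, hab']
  have hsurj := Finite.injective_iff_surjective.1 hinj
  rw [mem_lambdaPrimeShape hi]
  by_cases hk : t.colOf k = 0
  · have := hrow k
    omega
  obtain ⟨j, hj⟩ := hsurj ⟨s.rowOf k, hrow k⟩
  have hj : s.rowOf (e j) = s.rowOf k := by simpa using hj
  have hne : e j ≠ k := fun h' => hk (by rw [← h', he2])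
  have hcne : s.colOf (e j) ≠ s.colOf k := fun hc => hne (s.ext_rowOf_colOf hj hc)
  have h1 := hsm k
  have h2 := hsm (e j)
  have h3 := htm k
  by_cases hr : s.rowOf k = 1
  · by_cases hc : t.colOf k = 1
    · omega
    -- If k lay in row 1 of s but beyond column 1 of t, then k and `e j` would fill row 1. Both
    -- entries of column 1 of t would be forced into row 0, against injectivity.
    obtain ⟨b, hb1, hb2⟩ := t.exists_rowOf_colOf (r := 0) (c := 1)
      ((mem_lambdaPrimeShape hi).2 (by omega))
    obtain ⟨d, hd1, hd2⟩ := t.exists_rowOf_colOf (r := 1) (c := 1)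
      ((mem_lambdaPrimeShape hi).2 (by omega))
    have hbd : s.rowOf b ≠ s.rowOf d := fun hbd => by
      have := hs b d (by rw [hb2, hd2]) hbd
      rw [this] at hb1
      omega
    have hlow : ∀ y, t.colOf y = 1 → s.rowOf y = 0 := by
      intro y hy
      obtain ⟨l, hl⟩ := hsurj ⟨s.rowOf y, hrow y⟩
      have hl : s.rowOf (e l) = s.rowOf y := by simpa using hl
      have hney : s.colOf (e l) ≠ s.colOf y := fun hc => by
        have := s.ext_rowOf_colOf hl hc
        have := he2 l
        simp_all
      have hyk : s.rowOf y = 1 → s.colOf k ≠ s.colOf y := fun hy1 hc => by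
        have := s.ext_rowOf_colOf (hr.trans hy1.symm) hc
        rw [this] at hc
        simp_all
      have hyj : s.rowOf y = 1 → s.colOf (e j) ≠ s.colOf y := fun hy1 hc => by
        have := s.ext_rowOf_colOf (hj.trans (hr.trans hy1.symm)) hc
        have := he2 j
        simp_all
      have := hsm y
      have := hsm (e l)
      omega
    exact absurd ((hlow b hb2).trans (hlow d hd2).symm) hbd
  · omega

end YTableau

theorem exists_tableau_lambdaPrimeShape {h : i + 3 ≤ n} (hi : 1 ≤ i) (z : Fin n)
    (A : Finset (Fin n)) (hz : z ∉ A) (hA : #A = i) :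
    ∃ t : YTableau n (lambdaPrimeShape n i h), (t.rowOf z = 1 ∧ t.colOf z = 1) ∧
      (∀ k ∈ A, t.rowOf k ≠ 0 ∧ t.colOf k = 0) ∧ (∀ k, k ≠ z → k ∉ A → t.rowOf k = 0) := by
  classical
  -- Labels: 0 for A and the first column below the top row, 1 for z and the cell (1, 1), 2 for the
  -- rest and the top row. The tableau is glued from bijections between fibres of equal size.
  let f : Fin n → Fin 3 := fun k => if k = z then 1 else if k ∈ A then 0 else 2
  let g : ℕ × ℕ → Fin 3 := fun c => if c = (1, 1) then 1 else if c.1 = 0 then 2 else 0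
  have e : ∀ j, Nonempty ({k // f k = j} ≃
      {c : {c : ℕ × ℕ // c ∈ (lambdaPrimeShape n i h).cells} // g c = j}) := by
    intro j
    suffices ∃ (S : Finset (Fin n)) (T : Finset (ℕ × ℕ)), (∀ k, k ∈ S ↔ f k = j) ∧
        (∀ c, c ∈ T ↔ c ∈ (lambdaPrimeShape n i h).cells ∧ g c = j) ∧ #S = #T by
      obtain ⟨S, T, hS, hT, hc⟩ := this
      exact ⟨(Equiv.subtypeEquivRight hS).symm.trans ((Finset.equivOfCardEq hc).trans
        ((Equiv.subtypeEquivRight hT).trans (Equiv.subtypeSubtypeEquivSubtypeInter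
          (· ∈ (lambdaPrimeShape n i h).cells) (fun c => g c = j)).symm))⟩
    obtain rfl | rfl | rfl : j = 0 ∨ j = 1 ∨ j = 2 := by fin_cases j <;> simp
    · refine ⟨A, Icc 1 i ×ˢ {0}, fun k => ?_, ?_, by simp [hA]⟩
      · simp only [f]
        split_ifs with h1 h2
        · simp [h1, hz]
        · simp [h2]
        · simp [h2]
      · rintro ⟨r, c⟩
        rw [mem_lambdaPrimeShape hi]
        simp only [g, mem_product, mem_Icc, mem_singleton, Prod.mk.injEq]
        split_ifs <;> simp <;> omega
    · refine ⟨{z}, {(1, 1)}, fun k => ?_, ?_, by simp⟩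
      · simp only [f]
        split_ifs with h1 h2 <;> simp [h1]
      · rintro ⟨r, c⟩
        rw [mem_lambdaPrimeShape hi]
        simp only [g, mem_singleton, Prod.mk.injEq]
        split_ifs <;> simp <;> omega
    · refine ⟨(insert z A)ᶜ, {0} ×ˢ range (n - i - 1), fun k => ?_, ?_, ?_⟩
      · simp only [f]
        split_ifs with h1 h2
        · simp [h1]
        · simp [h2]
        · simp [h1, h2]
      · rintro ⟨r, c⟩
        rw [mem_lambdaPrimeShape hi]
        simp only [g, mem_product, mem_range, mem_singleton, Prod.mk.injEq]
        split_ifs <;> simp <;> omega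
      · rw [card_compl, card_insert_of_notMem hz, hA]
        simp
        omega
  let t : YTableau n (lambdaPrimeShape n i h) := Equiv.ofFiberEquiv fun j => (e j).some
  have ht : ∀ k, g (t.rowOf k, t.colOf k) = f k := fun k => Equiv.ofFiberEquiv_map (fun j => (e j).some) k
  have htm := fun k => (mem_lambdaPrimeShape hi).1 (t.mem_cells k)
  refine ⟨t, ?_, ?_, ?_⟩
  · have := ht z
    simp only [f, g, if_pos, Prod.mk.injEq] at this
    split_ifs at this with h1 h2
    · exact h1
    · simp at this
    · simp at this
  · intro k hk
    have hkz : k ≠ z := fun h' => hz (h' ▸ hk)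
    have h1 := ht k
    have h2 := htm k
    simp only [f, g, if_neg hkz, if_pos hk, Prod.mk.injEq] at h1
    split_ifs at h1 with h3 h4
    · simp at h1
    · simp at h1
    · omega
  · intro k hkz hk
    have h1 := ht k
    simp only [f, g, if_neg hkz, if_neg hk, Prod.mk.injEq] at h1
    split_ifs at h1 with h3 h4
    · simp at h1
    · exact h4
    · simp at h1

theorem exists_finset_notMem_card_eq {n m : ℕ} (z : Fin n) (hm : m < n) :
    ∃ A : Finset (Fin n), z ∉ A ∧ #A = m := by
  obtain ⟨A, hA, hc⟩ := exists_subset_card_eq (s := univ.erase z) (n := m) (by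
    rw [card_erase_of_mem (mem_univ z), card_univ, Fintype.card_fin]
    omega)
  exact ⟨A, fun hz => by simpa using hA hz, hc⟩

theorem spechtRep_lambdaPrimeShape_isIrreducible {h : i + 3 ≤ n} (hi : 1 ≤ i) :
    (spechtRep n (lambdaPrimeShape n i h)).IsIrreducible := by
  obtain ⟨A, hz, hA⟩ := exists_finset_notMem_card_eq (⟨0, by omega⟩ : Fin n) (show i < n by omega)
  obtain ⟨t, -⟩ := exists_tableau_lambdaPrimeShape (h := h) hi _ A hz hA
  exact SpechtModule.isIrreducible t fun s hs =>
    YTableau.lambdaPrimeShape_cells_of_injOn_columns t hi s hs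

/-- The restriction of a representation of the symmetric group to the stabilizer of a point. -/
noncomputable def restrictPointStabilizer (z : Fin n) {V : Type*} [AddCommGroup V] [Module ℂ V]
    (ρ : Representation ℂ (Perm (Fin n)) V) : Representation ℂ (Perm {x : Fin n // x ≠ z}) V :=
  ρ.comp Perm.ofSubtype

theorem restrictPointStabilizer_apply (z : Fin n) {V : Type*} [AddCommGroup V] [Module ℂ V]
    (ρ : Representation ℂ (Perm (Fin n)) V) (g : Perm {x : Fin n // x ≠ z}) :
    restrictPointStabilizer z ρ g = ρ (Perm.ofSubtype g) := rfl

/-! ### Which sign characters occur in the restricted Specht modules -/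

section Multiplicities

variable {h : i + 3 ≤ n} (z : Fin n) (A : Finset {x : Fin n // x ≠ z})

/-- The shape has i+1 rows, so a larger A has two points in one row of any tabloid. Swapping them
fixes the tabloid and negates its coefficient in the invariant vector. -/
theorem card_le_of_hasSignInvariant_spechtRep (hi : 1 ≤ i) (hA : HasSignInvariant
    (restrictPointStabilizer z (spechtRep n (lambdaPrimeShape n i h))) A) : #A ≤ i + 1 := by
  by_contra! hlt
  obtain ⟨v, hv, hinv⟩ := hA
  apply hv
  apply SpechtModule.incl_injective
  rw [map_zero]
  ext f
  rw [Finsupp.zero_apply]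
  by_contra hf
  obtain ⟨s, rfl⟩ := SpechtModule.apply_ne_zero hf
  obtain ⟨a, ha, b, hb, hab, hr⟩ := exists_ne_map_eq_of_card_lt_of_maps_to
    (s := A) (t := range (i + 1)) (by simpa using hlt) (f := fun a => s.rowOf a) (by
      intro a _
      have := (mem_lambdaPrimeShape hi).1 (s.mem_cells a)
      simp only [coe_range, Set.mem_Iio]
      omega)
  have h1 := hinv (swap a b) (stable_swap_of_mem ha hb)
  rw [signOn_swap_of_mem ha hb hab, restrictPointStabilizer_apply, Perm.ofSubtype_swap_eq] at h1
  have h2 := congrArg (fun v => SpechtModule.incl n _ v s.rowOf) h1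
  have h3 : s.rowOf ∘ swap (a : Fin n) b = s.rowOf := by
    funext k
    rw [Function.comp_apply, swap_apply_def]
    split_ifs with hk1 hk2
    · rw [hk1, hr]
    · rw [hk2, hr]
    · rfl
  simp only [map_smul, Finsupp.smul_apply, SpechtModule.incl_spechtRep, rowFillingRep_apply, h3,
    smul_eq_mul] at h2
  apply hf
  push_cast at h2
  linear_combination (-1 / 2 : ℂ) * h2

theorem sum_signOn_smul_mul_right {α V : Type*} [Fintype α] [DecidableEq α] [AddCommGroup V]
    [Module ℂ V] (ρ : Representation ℂ (Perm α) V) (A : Finset α) {g : Perm α}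
    (hg : ∀ x, g x ∈ A ↔ x ∈ A) (v : V) :
    ∑ h, (signOn A h : ℂ) • ρ h (ρ g v) = (signOn A g : ℂ) • ∑ h, (signOn A h : ℂ) • ρ h v := by
  rw [smul_sum]
  refine Fintype.sum_equiv (Equiv.mulRight g) _ _ fun h => ?_
  rw [Equiv.coe_mulRight, smul_smul, map_mul, Module.End.mul_apply]
  by_cases hh : ∀ x, h x ∈ A ↔ x ∈ A
  · rw [signOn_mul hh hg, mul_comm (signOn A h), ← Int.cast_mul, ← mul_assoc,
      signOn_mul_self hg, one_mul]
  · rw [signOn_of_not_stable hh, signOn_of_not_stable (h := h * g)]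
    · simp
    · intro hhg
      apply hh
      intro x
      have h1 := hhg (g⁻¹ x)
      rw [Perm.mul_apply, stable_inv hg] at h1
      simpa using h1

theorem sum_signOn_smul_mul_left {α V : Type*} [Fintype α] [DecidableEq α] [AddCommGroup V]
    [Module ℂ V] (ρ : Representation ℂ (Perm α) V) (A : Finset α) {g : Perm α}
    (hg : ∀ x, g x ∈ A ↔ x ∈ A) (v : V) :
    (signOn A g : ℂ) • ρ g (∑ h, (signOn A h : ℂ) • ρ h v) = ∑ h, (signOn A h : ℂ) • ρ h v := by
  rw [map_sum, smul_sum]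
  refine Fintype.sum_equiv (Equiv.mulLeft g) _ _ fun h => ?_
  rw [Equiv.coe_mulLeft, map_smul, smul_smul, map_mul, Module.End.mul_apply]
  by_cases hh : ∀ x, h x ∈ A ↔ x ∈ A
  · rw [signOn_mul hg hh, Int.cast_mul]
  · rw [signOn_of_not_stable hh, signOn_of_not_stable (h := g * h)]
    · simp
    · intro hhg
      apply hh
      intro x
      have h1 := hhg x
      rwa [Perm.mul_apply, hg] at h1

/-- If A is too small, two points outside A and z share a column of any tableau. Swapping them
negates the polytabloid but has `signOn` equal to 1, so the twisted average kills the whole module;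
yet it scales an invariant vector by the stabilizer order. -/
theorem le_card_of_hasSignInvariant_spechtRep (hi : 1 ≤ i) (hA : HasSignInvariant
    (restrictPointStabilizer z (spechtRep n (lambdaPrimeShape n i h))) A) : i ≤ #A := by
  classical
  by_contra! hlt
  obtain ⟨v, hv, hinv⟩ := hA
  apply hv
  set ρ := restrictPointStabilizer z (spechtRep n (lambdaPrimeShape n i h))
  have hzero : ∀ u, ∑ g, (signOn A g : ℂ) • ρ g u = 0 := by
    let T : SpechtModule n (lambdaPrimeShape n i h) →ₗ[ℂ] SpechtModule n (lambdaPrimeShape n i h) :=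
      ∑ g, (signOn A g : ℂ) • ρ g
    have hT : ∀ u, T u = ∑ g, (signOn A g : ℂ) • ρ g u := fun u => by simp [T]
    suffices T = 0 by
      intro u
      rw [← hT, this, LinearMap.zero_apply]
    apply LinearMap.ext_on SpechtModule.span_polytabloid
    rintro _ ⟨t, rfl⟩
    rw [LinearMap.zero_apply, hT]
    let C : Finset (Fin n) := {k | t.colOf k < 2}
    -- The first two columns have i+3 cells. Removing z and at most i-1 points of A leaves at least
    -- three entries in two columns.
    let D : Finset (ℕ × ℕ) := range (i + 1) ×ˢ {0} ∪ range 2 ×ˢ {1}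
    have hD : #D = i + 3 := by
      rw [card_union_of_disjoint]
      · simp
      · rw [disjoint_left]
        rintro ⟨r, c⟩
        simp
        omega
    have hDcells : ∀ c ∈ D, c ∈ (lambdaPrimeShape n i h).cells := by
      rintro ⟨r, c⟩ hc
      rw [mem_lambdaPrimeShape hi]
      simp [D] at hc
      omega
    have hC : i + 3 ≤ #C := by
      rw [← hD]
      have hsub : D ⊆ C.image fun k => (t.rowOf k, t.colOf k) := by
        rintro ⟨r, c⟩ hc
        obtain ⟨k, hk1, hk2⟩ := t.exists_rowOf_colOf (hDcells _ hc)
        refine mem_image.2 ⟨k, ?_, by rw [hk1, hk2]⟩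
        simp [D] at hc
        simp only [C, mem_filter, mem_univ, true_and]
        omega
      exact (card_le_card hsub).trans card_image_le
    let B : Finset (Fin n) := C \ insert z (A.map (Function.Embedding.subtype _))
    have hB : 2 < #B := by
      have h1 := le_card_sdiff (insert z (A.map (Function.Embedding.subtype _))) C
      have h2 := card_insert_le z (A.map (Function.Embedding.subtype (· ≠ z)))
      rw [card_map] at h2
      simp only [B]
      omega
    obtain ⟨a, ha, b, hb, hab, hcol⟩ := exists_ne_map_eq_of_card_lt_of_maps_to
      (s := B) (t := range 2) (by simpa using hB) (f := t.colOf) (by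
        intro a ha
        simp [B, C] at ha
        simp [ha.1])
    have hmem : ∀ a ∈ B, ∃ a' : {x : Fin n // x ≠ z}, a' ∉ A ∧ (a' : Fin n) = a := by
      intro a ha
      simp only [B, mem_sdiff, mem_insert, mem_map, Function.Embedding.coe_subtype, not_or,
        not_exists, not_and] at ha
      exact ⟨⟨a, ha.2.1⟩, fun h' => ha.2.2 _ h' rfl, rfl⟩
    obtain ⟨a', ha', rfl⟩ := hmem a ha
    obtain ⟨b', hb', rfl⟩ := hmem b hb
    have h1 := sum_signOn_smul_mul_right ρ A (stable_swap_of_notMem ha' hb')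
      (SpechtModule.polytabloid t)
    have h2 : ρ (swap a' b') (SpechtModule.polytabloid t) = -SpechtModule.polytabloid t := by
      apply SpechtModule.incl_injective
      rw [restrictPointStabilizer_apply, Perm.ofSubtype_swap_eq, SpechtModule.incl_spechtRep,
        SpechtModule.incl_polytabloid, YTableau.rowFillingRep_polytabloid_of_mem
        (YTableau.swap_mem_columnStabilizer hcol), Perm.sign_swap hab]
      simp
    rw [h2, signOn_swap_of_notMem ha' hb'] at h1
    simp only [map_neg, smul_neg, sum_neg_distrib, Int.cast_one, one_smul] at h1
    have h3 : (2 : ℂ) • ∑ g, (signOn A g : ℂ) • ρ g (SpechtModule.polytabloid t) = 0 := by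
      rw [two_smul]
      nth_rewrite 1 [← h1]
      exact neg_add_cancel _
    exact (smul_eq_zero.1 h3).resolve_left two_ne_zero
  have h1 : ∑ g, (signOn A g : ℂ) • ρ g v =
      (#{g : Perm {x : Fin n // x ≠ z} | ∀ x, g x ∈ A ↔ x ∈ A} : ℂ) • v := by
    rw [Nat.cast_smul_eq_nsmul, ← sum_const]
    symm
    apply sum_subset_zero_on_sdiff (filter_subset _ _)
    · intro g hg
      rw [signOn_of_not_stable (by simpa using hg)]
      simp
    · intro g hg
      exact (hinv g (mem_filter.1 hg).2).symm
  rw [hzero] at h1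
  rcases smul_eq_zero.1 h1.symm with h2 | h2
  · rw [Nat.cast_eq_zero, card_eq_zero, filter_eq_empty_iff] at h2
    exact absurd (fun x => Iff.rfl) (h2 (mem_univ 1))
  · exact h2

/-- The invariant is the twisted sum of the polytabloid of a tableau with A in the first column
below the top row and z at (1, 1). It is nonzero because all contributions to the coefficient of the
tabloid of t are nonnegative, and the one from the identities is 1. -/
theorem hasSignInvariant_spechtRep (hi : 1 ≤ i) (hA : #A = i) : HasSignInvariant
    (restrictPointStabilizer z (spechtRep n (lambdaPrimeShape n i h))) A := by
  classical
  obtain ⟨t, ⟨hz1, hz2⟩, htA, htB⟩ := exists_tableau_lambdaPrimeShape (h := h) hi z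
    (A.map (Function.Embedding.subtype _)) (by simp) (by rw [card_map, hA])
  set ρ := restrictPointStabilizer z (spechtRep n (lambdaPrimeShape n i h))
  refine ⟨∑ g, (signOn A g : ℂ) • ρ g (SpechtModule.polytabloid t), ?_,
    fun g hg => sum_signOn_smul_mul_left ρ A hg _⟩
  have htA' : ∀ k : {x : Fin n // x ≠ z}, k ∈ A → t.rowOf k ≠ 0 ∧ t.colOf k = 0 := fun k hk =>
    htA k (mem_map_of_mem _ hk)
  have htB' : ∀ k : {x : Fin n // x ≠ z}, k ∉ A → t.rowOf k = 0 := fun k hk =>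
    htB k k.2 (by simpa using fun _ => hk)
  let F : Perm {x : Fin n // x ≠ z} → Perm (Fin n) → ℤ := fun g q =>
    signOn A g * if t.rowOf ∘ ⇑q⁻¹ = t.rowOf ∘ Perm.ofSubtype g then
      ((Perm.sign q : ℤˣ) : ℤ) else 0
  have hcoef : SpechtModule.incl n _ (∑ g, (signOn A g : ℂ) • ρ g (SpechtModule.polytabloid t))
      t.rowOf = ((∑ g, ∑ q ∈ t.columnStabilizer, F g q : ℤ) : ℂ) := by
    rw [map_sum, Finsupp.finsetSum_apply, Int.cast_sum]
    refine sum_congr rfl fun g _ => ?_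
    rw [map_smul, Finsupp.smul_apply, restrictPointStabilizer_apply, SpechtModule.incl_spechtRep,
      rowFillingRep_apply, SpechtModule.incl_polytabloid, YTableau.polytabloid_apply, smul_eq_mul,
      ← Int.cast_mul, mul_sum]
  have hF : ∀ g, ∀ q ∈ t.columnStabilizer, 0 ≤ F g q := by
    intro g q hq
    simp only [F]
    split_ifs with hr
    swap
    · simp
    by_cases hg : ∀ x, g x ∈ A ↔ x ∈ A
    swap
    · simp [signOn_of_not_stable hg]
    have hqc := YTableau.mem_columnStabilizer.1 (YTableau.inv_mem_columnStabilizer hq)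
    have hr' : ∀ k, t.rowOf (q⁻¹ k) = t.rowOf (Perm.ofSubtype g k) := congrFun hr
    have hgz : Perm.ofSubtype g z = z := Perm.ofSubtype_apply_of_not_mem g (by simp)
    -- Comparing rows and columns forces q⁻¹ to agree with g on A and to fix everything else. The
    -- two signs in the term then coincide and multiply to 1.
    have hqz : q⁻¹ z = z := t.ext_rowOf_colOf (by rw [hr', hgz]) (hqc z)
    have hqA : ∀ k : {x : Fin n // x ≠ z}, k ∈ A → q⁻¹ k = g k := by
      intro k hk
      apply t.ext_rowOf_colOf
      · rw [hr', Perm.ofSubtype_apply_coe]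
      · rw [hqc, (htA' k hk).2, (htA' (g k) ((hg k).2 hk)).2]
    have hqB : ∀ k : {x : Fin n // x ≠ z}, k ∉ A → q⁻¹ k = k := by
      intro k hk
      apply t.ext_rowOf_colOf
      · rw [hr', Perm.ofSubtype_apply_coe, htB' k hk, htB' (g k) (fun h' => hk ((hg k).1 h'))]
      · exact hqc k
    have hst : ∀ x, q⁻¹ x ≠ z ↔ x ≠ z := by
      intro x
      rw [not_iff_not]
      constructor
      · intro hx
        exact (q⁻¹).injective (hx.trans hqz.symm)
      · rintro rfl
        exact hqz
    have hsign : signOn A g = ((Perm.sign q : ℤˣ) : ℤ) := by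
      rw [signOn_eq_sign (g := (q⁻¹).subtypePerm hst) (fun x hx => Subtype.ext (hqA x hx))
        (fun x hx => Subtype.ext (hqB x hx)) hg, Perm.sign_subtypePerm _ _ (by
          rintro x hx rfl
          exact hx hqz), Perm.sign_inv]
    rw [hsign, ← Units.val_mul, Int.units_mul_self]
    simp
  have hF1 : F 1 1 = 1 := by
    simp only [F, signOn_one, map_one, inv_one, if_pos, Units.val_one, one_mul]
  have hpos : 0 < ∑ g, ∑ q ∈ t.columnStabilizer, F g q := by
    refine sum_pos' (fun g _ => sum_nonneg (hF g)) ⟨1, mem_univ _, ?_⟩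
    exact sum_pos' (hF 1) ⟨1, t.one_mem_columnStabilizer, by rw [hF1]; exact one_pos⟩
  intro h0
  rw [h0, map_zero, Finsupp.zero_apply] at hcoef
  exact hpos.ne (by exact_mod_cast hcoef)

end Multiplicities

end LambdaPrimeShape

/-! ### The family `'Λ^i`: inequivalence, orthogonality and the bound at the cycle -/

section LambdaPrime

open Equiv Finset ComplexConjugate

/-- The finite orbit of a nonzero vector spans a nonzero subrepresentation. This permits E to be
given without a dimension hypothesis. -/
theorem Representation.IsIrreducible.finiteDimensional {G k V : Type*} [Group G] [Finite G] [Field k]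
    [AddCommGroup V] [Module k V] {ρ : Representation k G V} (hρ : ρ.IsIrreducible) :
    FiniteDimensional k V := by
  by_cases hV : Subsingleton V
  · infer_instance
  rw [not_subsingleton_iff_nontrivial] at hV
  obtain ⟨v, hv⟩ := exists_ne (0 : V)
  let U : Subrepresentation ρ :=
    { toSubmodule := Submodule.span k (Set.range fun g => ρ g v)
      apply_mem_toSubmodule := by
        intro g x hx
        induction hx using Submodule.span_induction with
        | mem x hx =>
          obtain ⟨h, rfl⟩ := hx
          refine Submodule.subset_span ⟨g * h, ?_⟩
          simp
        | zero => simp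
        | add x y _ _ hx hy => rw [map_add]; exact add_mem hx hy
        | smul a x _ hx => rw [map_smul]; exact Submodule.smul_mem _ a hx }
  have hvU : v ∈ U.toSubmodule := Submodule.subset_span ⟨1, by simp⟩
  rcases hρ.eq_bot_or_eq_top U with hU | hU
  · rw [hU] at hvU
    exact absurd ((Submodule.mem_bot k).1 hvU) hv
  · have htop : Submodule.span k (Set.range fun g => ρ g v) = ⊤ :=
      congrArg Subrepresentation.toSubmodule hU
    rw [FiniteDimensional, Module.finite_def, ← htop]
    exact Submodule.fg_span (Set.finite_range _)

theorem Representation.isIrreducible_of_self {G k : Type*} [Group G] [Field k]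
    (ρ : Representation k G k) : ρ.IsIrreducible := by
  have hnt : Nontrivial (Subrepresentation ρ) := by
    refine ⟨⊥, ⊤, fun hbt => ?_⟩
    have : (1 : k) ∈ (⊥ : Subrepresentation ρ).toSubmodule := by
      rw [hbt]
      exact Submodule.mem_top
    exact one_ne_zero ((Submodule.mem_bot k).1 this)
  refine { toNontrivial := hnt, eq_bot_or_eq_top := fun U => ?_ }
  rcases eq_bot_or_eq_top U.toSubmodule with h | h
  · exact Or.inl (Subrepresentation.toSubmodule_injective h)
  · exact Or.inr (Subrepresentation.toSubmodule_injective h)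

variable {n : ℕ}

/-- The action of the symmetric group on `lambdaPrime n i`. -/
noncomputable abbrev lambdaPrimeRep (n : ℕ) (i : Fin (n - 1)) :
    Representation ℂ (Perm (Fin n)) (lambdaPrime n i) := (lambdaPrime n i).ρ

theorem lambdaPrime_cases {i : Fin (n - 1)} {P : FDRep ℂ (Perm (Fin n)) → Prop}
    (h0 : (i : ℕ) = 0 → P (FDRep.of (Representation.trivial ℂ (Perm (Fin n)) ℂ)))
    (h1 : ∀ h : (i : ℕ) + 3 ≤ n, 1 ≤ (i : ℕ) → P (FDRep.of (spechtRep n (lambdaPrimeShape n i h))))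
    (h2 : (i : ℕ) + 2 = n → P (FDRep.of (signRep n))) : P (lambdaPrime n i) := by
  unfold lambdaPrime
  split_ifs with h h'
  · exact h0 h
  · exact h1 h' (by omega)
  · exact h2 (by have := i.2; omega)

theorem lambdaPrime_isIrreducible (i : Fin (n - 1)) :
    Representation.IsIrreducible (lambdaPrimeRep n i) := by
  apply lambdaPrime_cases (P := fun E => Representation.IsIrreducible E.ρ)
  · intro _
    exact Representation.isIrreducible_of_self (Representation.trivial ℂ (Perm (Fin n)) ℂ)
  · intro h hi
    exact spechtRep_lambdaPrimeShape_isIrreducible hi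
  · intro _
    exact Representation.isIrreducible_of_self (signRep n)

theorem signRep_apply (g : Perm (Fin n)) (v : ℂ) :
    signRep n g v = (((Perm.sign g : ℤˣ) : ℤ) : ℂ) * v := rfl

/-- At the two ends a transposition decides: inside A for the trivial representation, outside A for
the sign representation. -/
theorem card_of_hasSignInvariant_lambdaPrime (z : Fin n) (i : Fin (n - 1))
    (A : Finset {x : Fin n // x ≠ z})
    (hA : HasSignInvariant (restrictPointStabilizer z (lambdaPrimeRep n i)) A) :
    #A = i ∨ #A = (i : ℕ) + 1 := by
  revert hA
  apply lambdaPrime_cases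
    (P := fun E => HasSignInvariant (restrictPointStabilizer z E.ρ) A → #A = i ∨ #A = (i : ℕ) + 1)
  · intro hi hA
    change HasSignInvariant
      (restrictPointStabilizer z (Representation.trivial ℂ (Perm (Fin n)) ℂ)) A at hA
    by_contra hcard
    obtain ⟨v, hv, hinv⟩ := hA
    obtain ⟨a, ha, b, hb, hab⟩ := one_lt_card.1 (show 1 < #A by omega)
    have := hinv (swap a b) (stable_swap_of_mem ha hb)
    rw [signOn_swap_of_mem ha hb hab, restrictPointStabilizer_apply,
      Representation.trivial_apply] at this
    simp [neg_eq_self] at this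
    exact hv this
  · intro h hi hA
    have h1 := card_le_of_hasSignInvariant_spechtRep z A hi hA
    have h2 := le_card_of_hasSignInvariant_spechtRep z A hi hA
    omega
  · intro hi hA
    change HasSignInvariant (restrictPointStabilizer z (signRep n)) A at hA
    have hα : Fintype.card {x : Fin n // x ≠ z} = n - 1 := by simp
    have hle := card_le_univ A
    by_contra hcard
    obtain ⟨v, hv, hinv⟩ := hA
    obtain ⟨a, ha, b, hb, hab⟩ := one_lt_card.1 (show 1 < #Aᶜ by rw [card_compl]; omega)
    rw [mem_compl] at ha hb
    have := hinv (swap a b) (stable_swap_of_notMem ha hb)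
    rw [signOn_swap_of_notMem ha hb, restrictPointStabilizer_apply, signRep_apply,
      Perm.sign_ofSubtype, Perm.sign_swap hab] at this
    simp [neg_eq_self] at this
    exact hv this

theorem hasSignInvariant_lambdaPrime (z : Fin n) (i : Fin (n - 1))
    (A : Finset {x : Fin n // x ≠ z}) (hA : #A = i) :
    HasSignInvariant (restrictPointStabilizer z (lambdaPrimeRep n i)) A := by
  apply lambdaPrime_cases (P := fun E => HasSignInvariant (restrictPointStabilizer z E.ρ) A)
  · intro hi
    change HasSignInvariant (restrictPointStabilizer z (Representation.trivial ℂ (Perm (Fin n)) ℂ)) A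
    refine ⟨1, one_ne_zero, fun g _ => ?_⟩
    rw [card_eq_zero.1 (hA.trans hi), signOn_empty, restrictPointStabilizer_apply,
      Representation.trivial_apply]
    simp
  · intro h hi
    exact hasSignInvariant_spechtRep z A hi hA
  · intro hi
    change HasSignInvariant (restrictPointStabilizer z (signRep n)) A
    have hα : Fintype.card {x : Fin n // x ≠ z} = n - 1 := by simp
    refine ⟨1, one_ne_zero, fun g hg => ?_⟩
    have hfix : ∀ x, x ∉ A → g x = x := by
      intro x hx
      have hc : #Aᶜ ≤ 1 := by
        rw [card_compl]
        omega
      exact card_le_one.1 hc _ (by simpa [hg] using hx) _ (by simpa using hx)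
    rw [signOn_eq_sign (g := g) (fun _ _ => rfl) hfix hg, restrictPointStabilizer_apply,
      signRep_apply, Perm.sign_ofSubtype, smul_eq_mul, ← mul_assoc, ← Int.cast_mul,
      ← Units.val_mul, Int.units_mul_self]
    simp

/-- For i < j, a set of size i carries a sign invariant in `'Λ^i` but not in `'Λ^j`, where only the
sizes j and j+1 are possible. -/
theorem lambdaPrime_isEmpty_equiv (i j : Fin (n - 1)) (hij : i ≠ j) :
    IsEmpty ((lambdaPrimeRep n i).Equiv (lambdaPrimeRep n j)) := by
  have key : ∀ i j : Fin (n - 1), i < j →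
      IsEmpty ((lambdaPrimeRep n i).Equiv (lambdaPrimeRep n j)) := by
    intro i j hij
    refine ⟨fun φ => ?_⟩
    have hn : 0 < n := by have := i.2; omega
    let z : Fin n := ⟨0, hn⟩
    have hα : Fintype.card {x : Fin n // x ≠ z} = n - 1 := by simp
    obtain ⟨A, -, hA⟩ := exists_subset_card_eq (s := (univ : Finset {x : Fin n // x ≠ z}))
      (n := (i : ℕ)) (by rw [card_univ, hα]; exact i.2.le)
    have h1 := (hasSignInvariant_lambdaPrime z i A hA).of_equiv
      (σ := restrictPointStabilizer z (lambdaPrimeRep n j)) φ.toLinearEquiv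
      (fun g v => φ.toIntertwiningMap.isIntertwining _ _ (Perm.ofSubtype g) v)
    have h2 := card_of_hasSignInvariant_lambdaPrime z j A h1
    have h3 : (i : ℕ) < j := hij
    omega
  rcases lt_or_gt_of_ne hij with h | h
  · exact key i j h
  · refine ⟨fun φ => ?_⟩
    exact (key j i h).false φ.symm

theorem lambdaPrime_character_cycle (hn : 3 ≤ n) (w : Perm (Fin n)) (hw : w.IsCycle)
    (hcard : #w.support = n - 1) (i : Fin (n - 1)) :
    ∃ r : ℝ, 1 ≤ r ∧ (lambdaPrimeRep n i).character w = (-1) ^ (i : ℕ) * r := by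
  obtain ⟨z, hz⟩ : ∃ z, z ∉ w.support := by
    by_contra! hall
    rw [eq_univ_of_forall hall, card_univ, Fintype.card_fin] at hcard
    omega
  rw [Perm.notMem_support] at hz
  have hα : Fintype.card {x : Fin n // x ≠ z} = n - 1 := by simp
  have hst : ∀ x, w x ≠ z ↔ x ≠ z := by
    intro x
    rw [not_iff_not]
    constructor
    · intro hx
      exact w.injective (hx.trans hz.symm)
    · rintro rfl
      exact hz
  have hof : Perm.ofSubtype (w.subtypePerm (p := (· ≠ z)) hst) = w :=
    Perm.ofSubtype_subtypePerm (p := (· ≠ z)) hst (by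
    rintro x hx rfl
    exact hx hz)
  have hct : (w.subtypePerm (p := (· ≠ z)) hst).cycleType = {Fintype.card {x : Fin n // x ≠ z}} := by
    rw [← Perm.cycleType_ofSubtype, hof, hw.cycleType, hcard, hα]
  obtain ⟨r, hr, hχ⟩ := character_cycle_of_hasSignInvariant (by rw [hα]; omega)
    (restrictPointStabilizer z (lambdaPrimeRep n i)) _ hct (i := i) (by rw [hα]; exact i.2.le)
    (card_of_hasSignInvariant_lambdaPrime z i) (hasSignInvariant_lambdaPrime z i)
  refine ⟨r, hr, ?_⟩
  rw [← hχ, Representation.character, Representation.character, restrictPointStabilizer_apply, hof]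

theorem sum_character_mul_conj {G V W : Type*} [Group G] [Fintype G] [AddCommGroup V] [Module ℂ V]
    [FiniteDimensional ℂ V] [AddCommGroup W] [Module ℂ W] [FiniteDimensional ℂ W]
    (ρ : Representation ℂ G V) (σ : Representation ℂ G W) [ρ.IsIrreducible] [σ.IsIrreducible] :
    (Nonempty (σ.Equiv ρ) → ∑ g, ρ.character g * conj (σ.character g) = Fintype.card G) ∧
    (IsEmpty (σ.Equiv ρ) → ∑ g, ρ.character g * conj (σ.character g) = 0) := by
  classical
  have hne : (Nat.card G : ℂ) ≠ 0 := by
    exact_mod_cast Nat.card_pos.ne'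
  have := invertibleOfNonzero hne
  have key := Representation.char_orthonormal ρ σ
  rw [inv_mul_eq_iff_eq_mul₀ hne] at key
  simp_rw [← Representation.character_inv_eq_conj, key]
  constructor
  · intro h
    rw [if_pos h, mul_one, Nat.card_eq_fintype_card]
  · intro h
    rw [if_neg (not_nonempty_iff.2 h), mul_zero]

/-- The class of (n-1)-cycles has n (n-2)! elements, so n!/|class| = n-1. -/
theorem sum_norm_sq_character_cycle_le {ι : Type*} [Fintype ι] [DecidableEq ι] (hn : 3 ≤ n)
    (w : Perm (Fin n)) (hw : w.IsCycle) (hcard : #w.support = n - 1) (χ : ι → Perm (Fin n) → ℂ)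
    (hclass : ∀ i g h, IsConj g h → χ i g = χ i h)
    (horth : ∀ i j, ∑ g, χ i g * conj (χ j g) =
      if i = j then (Fintype.card (Perm (Fin n)) : ℂ) else 0) :
    ∑ i, ‖χ i w‖ ^ 2 ≤ (n - 1 : ℕ) := by
  have hct : w.cycleType = {n - 1} := by rw [hw.cycleType, hcard]
  refine sum_norm_sq_character_le χ hclass horth w (n - 1) {g | g.cycleType = {n - 1}} ?_ ?_
  · intro g
    rw [Perm.isConj_iff_cycleType_eq, hct, mem_filter, eq_comm]
    simp
  · rw [Perm.card_of_cycleType_singleton (by omega) (by simp), Fintype.card_perm, Fintype.card_fin]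
    obtain ⟨m, rfl⟩ : ∃ m, n = m + 2 := ⟨n - 2, by omega⟩
    have : (m + 2).choose (m + 2 - 1) = m + 2 := by
      rw [show m + 2 - 1 = m + 1 from rfl, Nat.choose_succ_self_right]
    rw [this, show m + 2 - 1 - 1 = m from rfl, show m + 2 - 1 = m + 1 from rfl,
      Nat.factorial_succ, Nat.factorial_succ]
    exact le_of_eq (by ring)

theorem Representation.character_eq_of_isConj {G V : Type*} [Group G] [AddCommGroup V] [Module ℂ V]
    [FiniteDimensional ℂ V] (ρ : Representation ℂ G V) {g h : G} (hgh : IsConj g h) :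
    ρ.character g = ρ.character h := by
  obtain ⟨c, rfl⟩ := isConj_iff.1 hgh
  simp

theorem sum_lambdaPrime_character_mul_conj (i j : Fin (n - 1)) :
    ∑ g, (lambdaPrimeRep n i).character g * conj ((lambdaPrimeRep n j).character g) =
      if i = j then (Fintype.card (Perm (Fin n)) : ℂ) else 0 := by
  have := lambdaPrime_isIrreducible i
  have := lambdaPrime_isIrreducible j
  have key := sum_character_mul_conj (lambdaPrimeRep n i) (lambdaPrimeRep n j)
  split_ifs with hij
  · subst hij
    exact key.1 ⟨Representation.Equiv.refl _⟩
  · exact key.2 (lambdaPrime_isEmpty_equiv j i (Ne.symm hij))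

end LambdaPrime

theorem mainTheorem2 (n : ℕ) (hn : 3 ≤ n) (w' : Equiv.Perm (Fin n))
    (hw' : w'.IsCycle) (hcard : w'.support.card = n - 1) :
    (∀ i : Fin (n - 1), Representation.IsIrreducible (lambdaPrime n i).ρ ∧
      (lambdaPrime n i).character w' = (-1 : ℂ) ^ (i : ℕ)) ∧
    (∀ {V : Type*} [AddCommGroup V] [Module ℂ V]
      (E : Representation ℂ (Equiv.Perm (Fin n)) V), E.IsIrreducible →
      (∀ i : Fin (n - 1), IsEmpty (E.Equiv (lambdaPrime n i).ρ)) →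
      E.character w' = 0) := by
  choose r hr hχ using lambdaPrime_character_cycle hn w' hw' hcard
  have hnorm : ∀ i, ‖(lambdaPrimeRep n i).character w'‖ ^ 2 = r i ^ 2 := fun i => by
    rw [hχ]
    simp
  have hsq : ∀ i, 1 ≤ r i ^ 2 := fun i => one_le_pow₀ (hr i)
  have hone : ((n - 1 : ℕ) : ℝ) = ∑ _i : Fin (n - 1), (1 : ℝ) := by simp
  refine ⟨fun i => ⟨lambdaPrime_isIrreducible i, ?_⟩, ?_⟩
  · have hb := sum_norm_sq_character_cycle_le hn w' hw' hcard
      (fun i => (lambdaPrimeRep n i).character)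
      (fun i _ _ h => (lambdaPrimeRep n i).character_eq_of_isConj h)
      sum_lambdaPrime_character_mul_conj
    simp_rw [hnorm] at hb
    -- The n-1 terms are each at least 1 and sum to at most n-1, so each is exactly 1.
    have heq : ∑ i, r i ^ 2 = ∑ _i : Fin (n - 1), (1 : ℝ) :=
      le_antisymm (hone ▸ hb) (Finset.sum_le_sum fun i _ => hsq i)
    have hi := (Finset.sum_eq_sum_iff_of_le fun i _ => hsq i).1 heq.symm i (Finset.mem_univ i)
    have hri : r i = 1 := by nlinarith [hr i]
    change (lambdaPrimeRep n i).character w' = _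
    rw [hχ, hri]
    simp
  · intro V _ _ E hE hne
    have := hE.finiteDimensional
    have hirr := fun i => lambdaPrime_isIrreducible (n := n) i
    -- Adjoining E as the index `none` keeps the family orthogonal, and the bound n-1 is already
    -- exhausted by the others.
    have hb := sum_norm_sq_character_cycle_le hn w' hw' hcard
      (fun o : Option (Fin (n - 1)) => o.elim E.character fun i => (lambdaPrimeRep n i).character)
      (by
        rintro (_ | i) g h hgh
        · exact E.character_eq_of_isConj hgh
        · exact (lambdaPrimeRep n i).character_eq_of_isConj hgh)
      (by
        rintro (_ | i) (_ | j)
        · rw [if_pos rfl]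
          exact (sum_character_mul_conj E E).1 ⟨Representation.Equiv.refl _⟩
        · rw [if_neg (by simp)]
          exact (sum_character_mul_conj E (lambdaPrimeRep n j)).2 ⟨fun φ => (hne j).false φ.symm⟩
        · rw [if_neg (by simp)]
          exact (sum_character_mul_conj (lambdaPrimeRep n i) E).2 (hne i)
        · simpa using sum_lambdaPrime_character_mul_conj i j)
    rw [Fintype.sum_option] at hb
    simp only [Option.elim] at hb
    simp_rw [hnorm] at hb
    rw [hone] at hb
    have hs := Finset.sum_le_sum fun (i : Fin (n - 1)) (_ : i ∈ Finset.univ) => hsq i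
    have h0 : ‖E.character w'‖ ^ 2 ≤ 0 := by linarith
    exact norm_eq_zero.1 (pow_eq_zero_iff two_ne_zero |>.1 (le_antisymm h0 (by positivity)))
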